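/- All Banach spaces are complex. $B_X$ is the closed unit ball of $X$, $X'$ the dual, and $X$ is regarded as a subspace of $X''$. Definitions. An L-projection on a Banach space $E$ is a bounded linear projection $P$ with $\|x\|=\|Px\|+\|x-Px\|$ for all $x$. A Banach space $X$ is L-embedded if $X$ is the range of an L-projection on $X''$. A Banach space $Z$ is M-embedded if it is an M-ideal in $Z''$, i.e. if its annihilator $Z^\perp\subset Z'''$ is the range of an L-projection on $Z'''$. Let $(x_n)_{n\ge1}$ be a sequence of nonzero vectors of a normed space. We say that - $(x_n)$ spans $\ell^1$ almost isometrically if there is a sequence $(\delta_m)$ in $[0,1)$, $\delta_m\to0$, such that $(1-\delta_m)\sum_{n\ge m}|\alpha_n|\le\big\|\sum_{n\ge m}\alpha_n\frac{x_n}{\|x_n\|}\big\|\le\sum_{n\ge m}|\alpha_n|$ for all $m$ and all (finitely supported) scalars $(\alpha_n)$, and asymptotically if there is such a sequence with $\sum_n(1-\delta_n)|\alpha_n|\le\big\|\sum_n\alpha_n\frac{x_n}{\|x_n\|}\big\|\le\sum_n|\alpha_n|$; - $(x_n)$ spans $c_0$ almost isometrically if there is a sequence $(\delta_m)$ in $[0,1)$,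 $\delta_m\to0$, such that $(1-\delta_m)\max_{m\le n\le m'}|\alpha_n|\le\big\|\sum_{n=m}^{m'}\alpha_n\frac{x_n}{\|x_n\|}\big\|\le(1-\delta_m)^{-1}\max_{m\le n\le m'}|\alpha_n|$ for all $m\le m'$, and asymptotically if there is such a sequence with $\max_{n\le m}(1-\delta_n)|\alpha_n|\le\big\|\sum_{n=1}^m\alpha_n\frac{x_n}{\|x_n\|}\big\|\le\max_{n\le m}(1-\delta_n)^{-1}|\alpha_n|$ for all $m$. A Banach space is almost (asymptotically) isometric to $\ell^1$, respectively $c_0$, if it has a Schauder basis with the corresponding property. An abstract measure topology on $X$ is a topology $\tau$ such that: (1) $\tau$ is sequential and $\tau$-limits of sequences are unique; (2) $\tau$ is weaker than the norm topology; (3) $x_n\to x$ in $\tau$ if and only if $x_n-x\to0$ in $\tau$; (4) every bounded sequence that spans $\ell^1$ asymptotically $\tau$-converges to $0$, and every sequence that $\tau$-converges to $0$ is bounded and has a subsequence that spans $\ell^1$ asymptotically or tends to $0$ in norm. If $X$ has exactly one such topology $\tau$, put $X^{\#}=\{x'\in X' : x'|_{B_X}\text{ is }\tau\text{-continuous}\}$.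 Proposition. Let $X$ be an L-embedded Banach space with a Schauder basis $(x_n)$ that spans $\ell^1$ almost isometrically, and let $(x_n')\subset X'$ be the biorthogonal functionals. Then $X$ has exactly one abstract measure topology; $X^{\#}$ is the closed linear span of $(x_n')$ in $X'$; $X^{\#}$ is M-embedded; the map $x\mapsto(z\mapsto z(x))$ is an isometric isomorphism of $X$ onto $(X^{\#})'$; and $(x_n')$ is a Schauder basis of $X^{\#}$ that spans $c_0$ almost isometrically (so $X^{\#}$ is almost isometric to $c_0$). The same holds with "asymptotically" in place of "almost isometrically" in both the hypothesis and the conclusion. -/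

import Mathlib

open Filter Topology

/-- The dual Banach space with its norm. (An abbreviation whose arguments are the normed structure,
so that it keeps its meaning when a further topology on `X` is under consideration.) -/
abbrev NDual (X : Type*) [NormedAddCommGroup X] [NormedSpace ℂ X] : Type _ := StrongDual ℂ X

/-! ### L-summands, M-ideals, L- and M-embedded spaces -/

/-- `Y` is the range of an L-projection on `E`. -/
def IsLSummand {E : Type*} [NormedAddCommGroup E] [NormedSpace ℂ E] (Y : Submodule ℂ E) : Prop :=
  ∃ P : E →L[ℂ] E, IsLprojection E P ∧ LinearMap.range (P : E →ₗ[ℂ] E) = Y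

/-- `Y` is a closed subspace whose annihilator is the range of an L-projection on the dual. -/
def IsMIdeal {E : Type*} [NormedAddCommGroup E] [NormedSpace ℂ E] (Y : Submodule ℂ E) : Prop :=
  IsClosed (Y : Set E) ∧ IsLSummand (StrongDual.polarSubmodule ℂ Y)

/-- The canonical copy of `X` in its bidual. -/
noncomputable def canonicalCopy (X : Type*) [NormedAddCommGroup X] [NormedSpace ℂ X] :
    Submodule ℂ (NDual (NDual X)) :=
  LinearMap.range (NormedSpace.inclusionInDoubleDual ℂ X : X →ₗ[ℂ] NDual (NDual X))

/-- `X` is an L-summand in its bidual. -/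
def IsLEmbedded (X : Type*) [NormedAddCommGroup X] [NormedSpace ℂ X] : Prop :=
  IsLSummand (canonicalCopy X)

/-- `X` is an M-ideal in its bidual. -/
def IsMEmbedded (X : Type*) [NormedAddCommGroup X] [NormedSpace ℂ X] : Prop :=
  IsMIdeal (canonicalCopy X)

/-! ### Sequences spanning `ℓ¹` and `c₀` -/

section Spans

variable {X : Type*} [NormedAddCommGroup X] [NormedSpace ℂ X]

/-- `x / ‖x‖` -/
noncomputable def normalize' (x : X) : X := ((‖x‖⁻¹ : ℝ) : ℂ) • x

/-- The sequence `x` spans `ℓ¹` `r`-isomorphically. Only finite sums are considered; the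
inequalities for infinite sums are their limits. -/
def SpansL1With (r : ℝ) (x : ℕ → X) : Prop :=
  0 < r ∧ (∀ n, x n ≠ 0) ∧ ∀ (s : Finset ℕ) (α : ℕ → ℂ),
    r * ∑ n ∈ s, ‖α n‖ ≤ ‖∑ n ∈ s, α n • normalize' (x n)‖ ∧
      ‖∑ n ∈ s, α n • normalize' (x n)‖ ≤ ∑ n ∈ s, ‖α n‖

/-- A null sequence in `[0, 1[`. -/
def IsNullSeq (δ : ℕ → ℝ) : Prop :=
  (∀ n, 0 ≤ δ n ∧ δ n < 1) ∧ Tendsto δ atTop (𝓝 0)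

/-- The sequence `x` spans `ℓ¹` almost isometrically. -/
def SpansL1Almost (x : ℕ → X) : Prop :=
  ∃ δ : ℕ → ℝ, IsNullSeq δ ∧ ∀ m, SpansL1With (1 - δ m) fun n => x (m + n)

/-- The sequence `x` spans `ℓ¹` asymptotically isometrically. -/
def SpansL1Asymp (x : ℕ → X) : Prop :=
  (∀ n, x n ≠ 0) ∧ ∃ δ : ℕ → ℝ, IsNullSeq δ ∧ ∀ (s : Finset ℕ) (α : ℕ → ℂ),
    ∑ n ∈ s, (1 - δ n) * ‖α n‖ ≤ ‖∑ n ∈ s, α n • normalize' (x n)‖ ∧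
      ‖∑ n ∈ s, α n • normalize' (x n)‖ ≤ ∑ n ∈ s, ‖α n‖

/-- The sequence `x` spans `c₀` almost isometrically. -/
def SpansC0Almost (x : ℕ → X) : Prop :=
  (∀ n, x n ≠ 0) ∧ ∃ δ : ℕ → ℝ, IsNullSeq δ ∧
    ∀ (m m' : ℕ) (h : m ≤ m') (α : ℕ → ℂ),
      (1 - δ m) * (Finset.Icc m m').sup' (Finset.nonempty_Icc.2 h) (fun n => ‖α n‖) ≤
          ‖∑ n ∈ Finset.Icc m m', α n • normalize' (x n)‖ ∧
        ‖∑ n ∈ Finset.Icc m m', α n • normalize' (x n)‖ ≤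
          (1 - δ m)⁻¹ * (Finset.Icc m m').sup' (Finset.nonempty_Icc.2 h) (fun n => ‖α n‖)

/-- The sequence `x` spans `c₀` asymptotically isometrically. -/
def SpansC0Asymp (x : ℕ → X) : Prop :=
  (∀ n, x n ≠ 0) ∧ ∃ δ : ℕ → ℝ, IsNullSeq δ ∧
    ∀ (m : ℕ) (α : ℕ → ℂ),
      (Finset.range (m + 1)).sup' Finset.nonempty_range_add_one (fun n => (1 - δ n) * ‖α n‖) ≤
          ‖∑ n ∈ Finset.range (m + 1), α n • normalize' (x n)‖ ∧
        ‖∑ n ∈ Finset.range (m + 1), α n • normalize' (x n)‖ ≤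
          (Finset.range (m + 1)).sup' Finset.nonempty_range_add_one
            (fun n => (1 - δ n)⁻¹ * ‖α n‖)

end Spans

/-! ### The abstract measure topology and `X^#` -/

/-- `τ` is an abstract measure topology on `X`. Convergence with respect to `τ` is written
`Tendsto _ atTop (@nhds X τ _)`. -/
structure IsAbstractMeasureTopology {X : Type*} [inst : NormedAddCommGroup X] [NormedSpace ℂ X]
    (τ : TopologicalSpace X) : Prop where
  sequential : @SequentialSpace X τ
  unique_limit : ∀ (u : ℕ → X) (a b : X),
    Tendsto u atTop (@nhds X τ a) → Tendsto u atTop (@nhds X τ b) → a = b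
  norm_le : inst.toMetricSpace.toPseudoMetricSpace.toUniformSpace.toTopologicalSpace ≤ τ
  translation : ∀ (u : ℕ → X) (a : X),
    Tendsto u atTop (@nhds X τ a) ↔ Tendsto (fun n => u n - a) atTop (@nhds X τ 0)
  tendsto_of_spans : ∀ u : ℕ → X, (∃ C : ℝ, ∀ n, ‖u n‖ ≤ C) → SpansL1Asymp u →
    Tendsto u atTop (@nhds X τ 0)
  of_tendsto : ∀ u : ℕ → X, Tendsto u atTop (@nhds X τ 0) →
    (∃ C : ℝ, ∀ n, ‖u n‖ ≤ C) ∧ ∃ φ : ℕ → ℕ, StrictMono φ ∧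
      (SpansL1Asymp (fun n => u (φ n)) ∨ Tendsto (fun n => ‖u (φ n)‖) atTop (𝓝 0))

/-- `X^#`: the functionals in `X'` whose restriction to the closed unit ball is `τ`-continuous. -/
def sharp {X : Type*} [NormedAddCommGroup X] [NormedSpace ℂ X] (τ : TopologicalSpace X) :
    Submodule ℂ (NDual X) where
  carrier := {f | @ContinuousOn X ℂ τ inferInstance (fun x => f x) {x : X | ‖x‖ ≤ 1}}
  zero_mem' := by
    simpa using @continuousOn_const X ℂ τ _ {x : X | ‖x‖ ≤ 1} 0
  add_mem' := fun hf hg => hf.add hg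
  smul_mem' := fun c _ hf => hf.const_smul c

/-! ### Coordinates with respect to the normalized basis. -/

section UnitBasis

variable {X : Type*} [NormedAddCommGroup X] [NormedSpace ℂ X]

/-! Write `e_n` for the normalized basis vectors. In the equivalent norm `l1Norm`, `X` is `ℓ¹`, and
the closed span `Z` of the coordinate functionals consists of the `f` with `f (e_n) → 0`
(`mem_coordSpan_iff`). Every element of `X''` is a vector of `X` plus a functional `Φ` annihilating
`Z` (`exists_annihilates_sub`), so the question is how the norm behaves under this decomposition.

Since `Φ` ignores finitely many coordinates, `Φ` and a far tail of `X` are almost in `ℓ¹`-position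
(`mul_norm_add_norm_le`). With Helly's theorem this makes `0` a best approximation of `Φ` in `X`
(`norm_le_norm_sub`). An L-projection onto `X` must then kill `Φ`, whence `‖Φ + y‖ = ‖Φ‖ + ‖y‖` for
all `y` in `X` (`norm_add_of_annihilates`). This equality makes `X` isometrically the dual of `Z`
and, read in `Z'''`, makes `Z` M-embedded.

Applied to weak* cluster points of blocks, the same equality shows that any finite-dimensional
subspace and a far tail of `X` are almost in `ℓ¹`-position
(`exists_tail_mul_le_of_finiteDimensional`). Three consequences follow. Coordinatewise null
sequences that stay away from `0` in norm have subsequences spanning `ℓ¹` asymptotically.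
Conversely, normalized sequences spanning `ℓ¹` asymptotically are coordinatewise null. Finally, the
`ℓ¹`-mass of `x` beyond `m` is at most about `‖x‖`, uniformly in `x`, which gives the `c₀`-estimates
by duality.

The first two consequences identify the null sequences of any abstract measure topology as the
bounded coordinatewise null sequences. A sequential topology is determined by its convergent
sequences, which gives uniqueness; existence is witnessed by `boundedCoordTopology`, and its `sharp`
is `Z`. -/

theorem norm_normalize' {x : X} (hx : x ≠ 0) : ‖normalize' x‖ = 1 := by
  have : ‖x‖ ≠ 0 := norm_ne_zero_iff.2 hx
  simp [normalize', norm_smul, this]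

theorem norm_smul_normalize' {x : X} (hx : x ≠ 0) : (‖x‖ : ℂ) • normalize' x = x := by
  have : (‖x‖ : ℂ) ≠ 0 := by simpa using hx
  simp [normalize', smul_smul, this]

theorem norm_sum_smul_normalize'_le (u : ℕ → X) (s : Finset ℕ) (α : ℕ → ℂ) :
    ‖∑ n ∈ s, α n • normalize' (u n)‖ ≤ ∑ n ∈ s, ‖α n‖ := by
  refine norm_sum_le_of_le _ fun n _ => ?_
  rw [norm_smul]
  rcases eq_or_ne (u n) 0 with h | h
  · simp [h, normalize']
  · simp [norm_normalize' h]

namespace SchauderBasis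

/-- The normalized basis vectors. -/
noncomputable def unitVec (b : SchauderBasis ℂ X) (n : ℕ) : X := normalize' (b n)

/-- The functionals biorthogonal to the normalized basis vectors. -/
noncomputable def unitCoord (b : SchauderBasis ℂ X) (n : ℕ) : NDual X :=
  (‖b n‖ : ℂ) • b.coord n

/-- The `ℓ¹`-norm of the coordinates with respect to the normalized basis. -/
noncomputable def l1Norm (b : SchauderBasis ℂ X) (x : X) : ℝ := ∑' n, ‖b.unitCoord n x‖

/-- The closed linear span of the basis vectors of index at least `m`. -/
noncomputable def tail (b : SchauderBasis ℂ X) (m : ℕ) : Submodule ℂ X where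
  carrier := {x | ∀ n < m, b.unitCoord n x = 0}
  zero_mem' := by simp
  add_mem' := fun hx hy n hn => by rw [map_add, hx n hn, hy n hn, add_zero]
  smul_mem' := fun c x hx n hn => by rw [map_smul, hx n hn, smul_zero]

/-- The closed linear span of the coordinate functionals. -/
noncomputable def coordSpan (b : SchauderBasis ℂ X) : Submodule ℂ (NDual X) :=
  (Submodule.span ℂ (Set.range b.coord)).topologicalClosure

/-- The normalized basis is almost isometric to the basis of `ℓ¹`. -/
structure IsAlmostL1 (b : SchauderBasis ℂ X) (δ : ℕ → ℝ) : Prop where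
  null : IsNullSeq δ
  ne_zero : ∀ n, b n ≠ 0
  lower : ∀ (m : ℕ) (s : Finset ℕ), (∀ n ∈ s, m ≤ n) → ∀ α : ℕ → ℂ,
    (1 - δ m) * ∑ n ∈ s, ‖α n‖ ≤ ‖∑ n ∈ s, α n • b.unitVec n‖

variable {b : SchauderBasis ℂ X} {δ : ℕ → ℝ}

theorem l1Norm_nonneg (x : X) : 0 ≤ b.l1Norm x := tsum_nonneg fun _ => norm_nonneg _

theorem mem_tail {m : ℕ} {x : X} : x ∈ b.tail m ↔ ∀ n < m, b.unitCoord n x = 0 := Iff.rfl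

theorem unitCoord_unitVec (hb : ∀ n, b n ≠ 0) (i j : ℕ) :
    b.unitCoord i (b.unitVec j) = if i = j then 1 else 0 := by
  have : (‖b i‖ : ℂ) ≠ 0 := by simpa using hb i
  rcases eq_or_ne i j with rfl | h
  · simp [unitCoord, unitVec, normalize', b.ortho, this]
  · simp [unitCoord, unitVec, normalize', b.ortho, h]

theorem unitVec_mem_tail (hb : ∀ n, b n ≠ 0) {m n : ℕ} (h : m ≤ n) : b.unitVec n ∈ b.tail m := by
  intro k hk
  rw [unitCoord_unitVec hb, if_neg (by omega)]

theorem coord_smul_eq (hb : ∀ n, b n ≠ 0) (n : ℕ) (x : X) :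
    b.coord n x • b n = b.unitCoord n x • b.unitVec n := by
  conv_lhs => rw [← norm_smul_normalize' (hb n), smul_smul, mul_comm]
  rfl

theorem proj_eq_sum (hb : ∀ n, b n ≠ 0) (n : ℕ) (x : X) :
    b.proj n x = ∑ i ∈ Finset.range n, b.unitCoord i x • b.unitVec i := by
  simp [coord_smul_eq hb]

theorem unitCoord_proj (hb : ∀ n, b n ≠ 0) (m n : ℕ) (x : X) :
    b.unitCoord n (b.proj m x) = if n < m then b.unitCoord n x else 0 := by
  rw [proj_eq_sum hb, map_sum]
  simp [unitCoord_unitVec hb]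

theorem sub_proj_mem_tail (hb : ∀ n, b n ≠ 0) (m : ℕ) (x : X) : x - b.proj m x ∈ b.tail m := by
  intro n hn
  rw [map_sub, unitCoord_proj hb, if_pos hn, sub_self]

theorem tail_anti {m n : ℕ} (h : m ≤ n) : b.tail n ≤ b.tail m :=
  fun _ hx k hk => hx k (hk.trans_le h)

theorem unitCoord_mem_span (b : SchauderBasis ℂ X) (n : ℕ) :
    b.unitCoord n ∈ Submodule.span ℂ (Set.range b.coord) :=
  Submodule.smul_mem _ _ (Submodule.subset_span ⟨n, rfl⟩)

/-- Two functionals that agree on a tail of the basis differ by a combination of coordinate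
functionals. -/
theorem eq_add_sum_of_eq_tail (hb : ∀ n, b n ≠ 0) {M : ℕ} {F G : NDual X}
    (h : ∀ n ≥ M, F (b.unitVec n) = G (b.unitVec n)) :
    F = G + ∑ i ∈ Finset.range M, (F - G) (b.unitVec i) • b.unitCoord i := by
  ext x
  have h1 : (F - G) x = (F - G) (b.proj M x) := by
    rw [← sub_eq_zero, ← map_sub]
    have h2 := ((F - G).continuous.tendsto _).comp (b.tendsto_proj (x - b.proj M x))
    refine tendsto_nhds_unique h2 (tendsto_const_nhds.congr fun n => ?_)
    rw [Function.comp_apply, proj_eq_sum hb, map_sum]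
    refine (Finset.sum_eq_zero fun i _ => ?_).symm
    rcases lt_or_ge i M with hi | hi
    · rw [sub_proj_mem_tail hb M x i hi, zero_smul, map_zero]
    · rw [map_smul, sub_apply, h i hi, sub_self, smul_zero]
  have h3 : F x = G x + (F - G) x := by simp
  rw [h3, h1, proj_eq_sum hb, map_sum]
  simp [_root_.sum_apply, mul_comm]

namespace IsAlmostL1

variable (h : b.IsAlmostL1 δ)
include h

theorem one_sub_pos (m : ℕ) : 0 < 1 - δ m := by linarith [(h.null.1 m).2]

theorem norm_unitVec (n : ℕ) : ‖b.unitVec n‖ = 1 := norm_normalize' (h.ne_zero n)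

theorem sum_norm_unitCoord_le {m : ℕ} {x : X} (hx : x ∈ b.tail m) (n : ℕ) :
    (1 - δ m) * ∑ i ∈ Finset.range n, ‖b.unitCoord i x‖ ≤ ‖b.proj n x‖ := by
  have h1 := h.lower m (Finset.range n \ Finset.range m) (by simp) (fun i => b.unitCoord i x)
  rw [proj_eq_sum h.ne_zero]
  have h2 : ∀ i ∈ Finset.range n, i ∉ Finset.range n \ Finset.range m → b.unitCoord i x = 0 := by
    intro i hi hi'
    apply hx
    simp at hi hi'
    exact hi' hi
  rwa [Finset.sum_subset Finset.sdiff_subset (fun i hi hi' => by rw [h2 i hi hi', norm_zero]),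
    Finset.sum_subset Finset.sdiff_subset (fun i hi hi' => by rw [h2 i hi hi', zero_smul])] at h1

theorem summable (x : X) : Summable fun n => ‖b.unitCoord n x‖ := by
  obtain ⟨C, hC⟩ := (b.tendsto_proj x).norm.bddAbove_range
  refine summable_of_sum_range_le (c := C / (1 - δ 0)) (fun _ => norm_nonneg _) fun n => ?_
  rw [le_div_iff₀' (h.one_sub_pos 0)]
  exact (h.sum_norm_unitCoord_le (m := 0) (x := x) (by simp [mem_tail]) n).trans (hC ⟨n, rfl⟩)

theorem mul_l1Norm_le {m : ℕ} {x : X} (hx : x ∈ b.tail m) : (1 - δ m) * b.l1Norm x ≤ ‖x‖ :=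
  le_of_tendsto_of_tendsto' ((h.summable x).hasSum.tendsto_sum_nat.const_mul _)
    (b.tendsto_proj x).norm (h.sum_norm_unitCoord_le hx)

theorem mul_l1Norm_le' (x : X) : (1 - δ 0) * b.l1Norm x ≤ ‖x‖ :=
  h.mul_l1Norm_le (by simp [mem_tail])

theorem hasSum [CompleteSpace X] (x : X) :
    HasSum (fun n => b.unitCoord n x • b.unitVec n) x := by
  have h1 : Summable fun n => b.unitCoord n x • b.unitVec n := by
    refine Summable.of_norm ((h.summable x).congr fun n => ?_)
    rw [norm_smul, h.norm_unitVec, mul_one]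
  have h2 := b.tendsto_proj x
  simp_rw [proj_eq_sum h.ne_zero] at h2
  have h3 := h1.hasSum
  rwa [tendsto_nhds_unique h1.hasSum.tendsto_sum_nat h2] at h3

theorem norm_le_l1Norm [CompleteSpace X] (x : X) : ‖x‖ ≤ b.l1Norm x := by
  have h1 := (h.hasSum x).tsum_eq
  conv_lhs => rw [← h1]
  refine tsum_of_norm_bounded (h.summable x).hasSum fun n => ?_
  rw [norm_smul, h.norm_unitVec, mul_one]

theorem hasSum_apply [CompleteSpace X] (f : NDual X) (x : X) :
    HasSum (fun n => b.unitCoord n x * f (b.unitVec n)) (f x) := by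
  simpa using! (h.hasSum x).mapL f

/-- Vectors with prescribed absolutely summable coordinates. -/
theorem exists_vector [CompleteSpace X] {a : ℕ → ℂ} (ha : Summable fun n => ‖a n‖) :
    ∃ x, ∀ n, b.unitCoord n x = a n := by
  have h1 : Summable fun n => a n • b.unitVec n := by
    refine Summable.of_norm (ha.congr fun n => ?_)
    rw [norm_smul, h.norm_unitVec, mul_one]
  refine ⟨_, fun n => ((h1.hasSum.mapL (b.unitCoord n)).unique ?_)⟩
  simp only [map_smul, unitCoord_unitVec h.ne_zero]
  have h2 : (fun k => a k • if n = k then (1 : ℂ) else 0) = fun k => if k = n then a n else 0 := by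
    funext k
    rcases eq_or_ne n k with rfl | hk
    · simp
    · simp [hk, Ne.symm hk]
  rw [h2]
  exact hasSum_ite_eq n (a n)

theorem l1Norm_mono {x y : X} (hxy : ∀ n, ‖b.unitCoord n x‖ ≤ ‖b.unitCoord n y‖) :
    b.l1Norm x ≤ b.l1Norm y :=
  (h.summable x).tsum_le_tsum hxy (h.summable y)

theorem l1Norm_sub_proj_le (m : ℕ) (x : X) : b.l1Norm (x - b.proj m x) ≤ b.l1Norm x := by
  refine h.l1Norm_mono fun n => ?_
  rw [map_sub, unitCoord_proj h.ne_zero]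
  split_ifs <;> simp

theorem l1Norm_sub_proj_anti {m m' : ℕ} (hm : m ≤ m') (x : X) :
    b.l1Norm (x - b.proj m' x) ≤ b.l1Norm (x - b.proj m x) := by
  refine h.l1Norm_mono fun n => ?_
  rw [map_sub, unitCoord_proj h.ne_zero, map_sub, unitCoord_proj h.ne_zero]
  split_ifs <;> first | omega | simp

theorem norm_tsum_le {g : ℕ → ℂ} {c : ℝ} (hg : ∀ n, ‖g n‖ ≤ c) (x : X) :
    Summable (fun n => b.unitCoord n x * g n) ∧
      ‖∑' n, b.unitCoord n x * g n‖ ≤ c * b.l1Norm x := by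
  have hb : ∀ n, ‖b.unitCoord n x * g n‖ ≤ c * ‖b.unitCoord n x‖ := fun n => by
    rw [norm_mul, mul_comm]
    exact mul_le_mul_of_nonneg_right (hg n) (norm_nonneg _)
  exact ⟨Summable.of_norm_bounded ((h.summable x).mul_left c) hb,
    tsum_of_norm_bounded ((h.summable x).hasSum.mul_left c) hb⟩

/-- On a tail, a bounded sequence of values at the basis vectors comes from a functional of norm
at most one. -/
theorem exists_functional (m : ℕ) {g : ℕ → ℂ} (hg : ∀ n, ‖g n‖ ≤ 1) :
    ∃ G : NDual X, ‖G‖ ≤ 1 ∧ ∀ n ≥ m, G (b.unitVec n) = (1 - δ m : ℝ) * g n := by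
  have hd := h.one_sub_pos m
  -- On the tail `(1 - δ m) * l1Norm` is at most the norm, so the factor `1 - δ m` turns the
  -- `ℓ¹`-pairing with `g` into a contraction, and Hahn–Banach applies.
  let A : b.tail m →ₗ[ℂ] ℂ :=
    { toFun := fun x => (1 - δ m : ℝ) * ∑' n, b.unitCoord n (x : X) * g n
      map_add' := fun x y => by
        rw [← mul_add, ← (h.norm_tsum_le hg x).1.tsum_add (h.norm_tsum_le hg y).1]
        simp [add_mul]
      map_smul' := fun c x => by
        simp [mul_assoc, tsum_mul_left]
        ring }
  have hA : ∀ x, ‖A x‖ ≤ 1 * ‖x‖ := fun x => by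
    change ‖((1 - δ m : ℝ) : ℂ) * ∑' n, b.unitCoord n (x : X) * g n‖ ≤ _
    rw [norm_mul, Complex.norm_real, Real.norm_of_nonneg hd.le, one_mul]
    refine le_trans ?_ (h.mul_l1Norm_le x.2)
    have := (h.norm_tsum_le hg (x : X)).2
    rw [one_mul] at this
    exact mul_le_mul_of_nonneg_left this hd.le
  obtain ⟨G, hG, hG'⟩ := exists_extension_norm_eq (b.tail m) (A.mkContinuous 1 hA)
  refine ⟨G, hG'.trans_le (A.mkContinuous_norm_le zero_le_one hA), fun n hn => ?_⟩
  have h1 := hG ⟨_, unitVec_mem_tail h.ne_zero hn⟩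
  rw [h1]
  change ((1 - δ m : ℝ) : ℂ) * ∑' k, b.unitCoord k (b.unitVec n) * g k = _
  congr 1
  rw [tsum_eq_single n]
  · simp [unitCoord_unitVec h.ne_zero]
  · intro k hk
    simp [unitCoord_unitVec h.ne_zero, hk]

/-- The norm of a functional is controlled by its values at the basis vectors. -/
theorem norm_functional_le [CompleteSpace X] {f : NDual X} {c : ℝ}
    (hf : ∀ n, ‖f (b.unitVec n)‖ ≤ c) : ‖f‖ ≤ c * (1 - δ 0)⁻¹ := by
  have hd := h.one_sub_pos 0
  have hc : 0 ≤ c := (norm_nonneg _).trans (hf 0)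
  refine f.opNorm_le_bound (by positivity) fun x => ?_
  rw [← (h.hasSum_apply f x).tsum_eq, mul_assoc]
  refine (h.norm_tsum_le hf x).2.trans (mul_le_mul_of_nonneg_left ?_ hc)
  rw [inv_mul_eq_div, le_div_iff₀' hd]
  exact h.mul_l1Norm_le' x

theorem tendsto_apply_unitVec_of_mem {z : NDual X} (hz : z ∈ b.coordSpan) :
    Tendsto (fun n => z (b.unitVec n)) atTop (𝓝 0) := by
  rw [coordSpan, ← SetLike.mem_coe, Submodule.topologicalClosure_coe] at hz
  rw [Metric.tendsto_atTop]
  intro ε hε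
  obtain ⟨w, hw, hwz⟩ := Metric.mem_closure_iff.1 hz (ε / 2) (by positivity)
  have h1 : Tendsto (fun n => w (b.unitVec n)) atTop (𝓝 0) := by
    refine Submodule.span_induction (p := fun w _ => Tendsto (fun n => w (b.unitVec n)) atTop (𝓝 0))
      ?_ ?_ ?_ ?_ hw
    · rintro _ ⟨k, rfl⟩
      refine tendsto_const_nhds.congr' ?_
      filter_upwards [eventually_gt_atTop k] with n hn
      simp [unitVec, normalize', b.ortho, hn.ne]
    · simp
    · intro x y _ _ hx hy
      simpa using hx.add hy
    · intro a x _ hx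
      simpa using hx.const_mul a
  obtain ⟨N, hN⟩ := Metric.tendsto_atTop.1 h1 (ε / 2) (by positivity)
  refine ⟨N, fun n hn => ?_⟩
  have h2 := hN n hn
  rw [dist_zero_right] at h2 ⊢
  have h3 : ‖(z - w) (b.unitVec n)‖ ≤ ‖z - w‖ := by
    simpa [h.norm_unitVec] using (z - w).le_opNorm (b.unitVec n)
  rw [dist_eq_norm] at hwz
  calc ‖z (b.unitVec n)‖ = ‖(z - w) (b.unitVec n) + w (b.unitVec n)‖ := by simp
    _ ≤ _ := norm_add_le _ _
    _ < ε := by linarith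

theorem tendsto_sum_unitCoord [CompleteSpace X] {z : NDual X}
    (hz : Tendsto (fun n => z (b.unitVec n)) atTop (𝓝 0)) :
    Tendsto (fun n => ∑ i ∈ Finset.range n, z (b.unitVec i) • b.unitCoord i) atTop (𝓝 z) := by
  have hd := h.one_sub_pos 0
  rw [Metric.tendsto_atTop] at hz ⊢
  intro ε hε
  obtain ⟨N, hN⟩ := hz (ε / 2 * (1 - δ 0)) (by positivity)
  refine ⟨N, fun n hn => ?_⟩
  have h1 : ‖(∑ i ∈ Finset.range n, z (b.unitVec i) • b.unitCoord i) - z‖ ≤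
      (ε / 2 * (1 - δ 0)) * (1 - δ 0)⁻¹ := by
    refine h.norm_functional_le fun k => ?_
    have h2 : (∑ i ∈ Finset.range n, z (b.unitVec i) • b.unitCoord i) (b.unitVec k) =
        if k < n then z (b.unitVec k) else 0 := by
      simp [_root_.sum_apply, unitCoord_unitVec h.ne_zero]
    rw [sub_apply, h2]
    split_ifs with hk
    · simp
      positivity
    · have := hN k (by omega)
      rw [dist_zero_right] at this
      simpa using this.le
  rw [dist_eq_norm]
  rw [mul_assoc, mul_inv_cancel₀ hd.ne', mul_one] at h1
  linarith

/-- The dual norm is equivalent to the supremum of the values at the unit vectors. Thus `X'` is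
`ℓ^∞` up to renorming, and the coordinates span its copy of `c₀`. -/
theorem mem_coordSpan_iff [CompleteSpace X] {z : NDual X} :
    z ∈ b.coordSpan ↔ Tendsto (fun n => z (b.unitVec n)) atTop (𝓝 0) := by
  refine ⟨h.tendsto_apply_unitVec_of_mem, fun hz => ?_⟩
  rw [coordSpan, ← SetLike.mem_coe, Submodule.topologicalClosure_coe]
  exact mem_closure_of_tendsto (h.tendsto_sum_unitCoord hz) (Eventually.of_forall fun n =>
    Submodule.sum_mem _ fun i _ => Submodule.smul_mem _ _ (b.unitCoord_mem_span i))

end IsAlmostL1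

end SchauderBasis

end UnitBasis

/-! ### Elements of the bidual, and functionals annihilating the coordinates. -/

section Bidual

variable {X : Type*} [NormedAddCommGroup X] [NormedSpace ℂ X]

local notation "ι" => NormedSpace.inclusionInDoubleDual ℂ

theorem norm_inclusionInDoubleDual (x : X) : ‖ι X x‖ = ‖x‖ :=
  (NormedSpace.inclusionInDoubleDualLi ℂ (E := X)).norm_map x

/-- A unimodular number rotating `z` to the positive real axis. -/
noncomputable def conjPhase (z : ℂ) : ℂ := if z = 0 then 0 else (‖z‖ : ℂ) / z

theorem conjPhase_mul (z : ℂ) : z * conjPhase z = ‖z‖ := by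
  rcases eq_or_ne z 0 with rfl | h
  · simp
  · rw [conjPhase, if_neg h, mul_div_cancel₀ _ h]

theorem norm_conjPhase_le (z : ℂ) : ‖conjPhase z‖ ≤ 1 := by
  rcases eq_or_ne z 0 with rfl | h
  · simp [conjPhase]
  · simp [conjPhase, h]

/-- A functional is almost normed by a vector at which its value is real. -/
theorem exists_re_apply_gt {E : Type*} [NormedAddCommGroup E] [NormedSpace ℂ E]
    (Φ : NDual E) {ε : ℝ} (hε : 0 < ε) : ∃ f : E, ‖f‖ ≤ 1 ∧ ‖Φ‖ - ε < (Φ f).re := by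
  by_contra! H
  have h0 : 0 ≤ ‖Φ‖ - ε := by simpa using H 0 (by simp)
  have : ‖Φ‖ ≤ ‖Φ‖ - ε := by
    refine ContinuousLinearMap.opNorm_le_of_unit_norm (𝕜 := ℂ) h0 fun f hf => ?_
    have h1 := H (conjPhase (Φ f) • f) (by
      rw [norm_smul, hf, mul_one]; exact norm_conjPhase_le _)
    rwa [map_smul, smul_eq_mul, mul_comm, conjPhase_mul, Complex.ofReal_re] at h1
  linarith

/-- Helly's theorem: an element of the bidual is approximated at finitely many functionals by
vectors of no larger norm. -/
theorem exists_norm_le_forall_apply_near (Φ : NDual (NDual X)) (S : Finset (NDual X)) {ε : ℝ}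
    (hε : 0 < ε) : ∃ s : X, ‖s‖ ≤ ‖Φ‖ ∧ ∀ f ∈ S, ‖f s - Φ f‖ < ε := by
  classical
  let T : X →L[ℂ] (S → ℂ) := ContinuousLinearMap.pi fun f => (f : NDual X)
  let v : S → ℂ := fun f => Φ f
  have hconv : Convex ℝ (T '' Metric.closedBall 0 ‖Φ‖) :=
    (convex_closedBall _ _).linear_image (T.toLinearMap.restrictScalars ℝ)
  have hmem : v ∈ closure (T '' Metric.closedBall 0 ‖Φ‖) := by
    by_contra hv
    -- A separating `g` corresponds to a combination `F` of the functionals in `S`, with `Φ F = g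
    -- v`. The supremum of `Re F` over the ball of radius `‖Φ‖` is `‖Φ‖ * ‖F‖`, which `Re (Φ F)`
    -- cannot exceed.
    obtain ⟨g, u, hu, huv⟩ := RCLike.geometric_hahn_banach_closed_point (𝕜 := ℂ)
      hconv.closure isClosed_closure hv
    let F : NDual X := g.comp T
    have hF : F = ∑ f : S, g (Pi.single f 1) • (f : NDual X) := by
      ext x
      have : T x = ∑ f : S, T x f • (Pi.single f 1 : S → ℂ) := pi_eq_sum_univ' (T x)
      change g (T x) = _
      rw [this, map_sum]
      simp [_root_.sum_apply, T, mul_comm]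
    have hΦF : Φ F = g v := by
      rw [hF, map_sum, pi_eq_sum_univ' v, map_sum]
      simp [v, mul_comm]
    have hle : ‖Φ‖ * ‖F‖ ≤ u := by
      refine le_of_forall_pos_le_add fun η hη => ?_
      have hp : 0 < ‖Φ‖ + 1 := by positivity
      obtain ⟨x, hx, hx'⟩ := exists_re_apply_gt F (div_pos hη hp)
      have h1 := hu (T ((‖Φ‖ : ℂ) • x)) (subset_closure ⟨_, by
        simpa [norm_smul] using mul_le_of_le_one_right (norm_nonneg Φ) hx, rfl⟩)
      have h2 : RCLike.re (g (T ((‖Φ‖ : ℂ) • x))) = ‖Φ‖ * (F x).re := by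
        simp [F]
      rw [h2] at h1
      have h3 : ‖Φ‖ * (‖F‖ - η / (‖Φ‖ + 1)) ≤ ‖Φ‖ * (F x).re :=
        mul_le_mul_of_nonneg_left hx'.le (norm_nonneg _)
      have h4 : ‖Φ‖ * (η / (‖Φ‖ + 1)) ≤ η := by
        rw [mul_div_assoc', div_le_iff₀ hp]
        nlinarith
      linarith
    have h5 : (Φ F).re ≤ ‖Φ‖ * ‖F‖ := (Complex.re_le_norm _).trans (Φ.le_opNorm F)
    rw [hΦF] at h5
    exact absurd (huv.trans_le h5) (not_lt.2 hle)
  obtain ⟨_, ⟨s, hs, rfl⟩, hs'⟩ := Metric.mem_closure_iff.1 hmem ε hε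
  refine ⟨s, by simpa using hs, fun f hf => ?_⟩
  rw [dist_comm, dist_eq_norm] at hs'
  exact (norm_le_pi_norm (T s - v) ⟨f, hf⟩).trans_lt hs'

/-- A bounded sequence has a limit in the bidual along every ultrafilter. -/
theorem exists_ultrafilter_limit {v : ℕ → X} {C : ℝ} (hv : ∀ k, ‖v k‖ ≤ C) (U : Ultrafilter ℕ) :
    ∃ Φ : NDual (NDual X), ∀ f : NDual X, Tendsto (fun k => f (v k)) U (𝓝 (Φ f)) := by
  have h1 : ∀ f : NDual X, ∃ a : ℂ, ‖a‖ ≤ C * ‖f‖ ∧ Tendsto (fun k => f (v k)) U (𝓝 a) := by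
    intro f
    have hK : ∀ k, f (v k) ∈ Metric.closedBall (0 : ℂ) (C * ‖f‖) := fun k => by
      rw [mem_closedBall_zero_iff, mul_comm]
      exact (f.le_opNorm _).trans (mul_le_mul_of_nonneg_left (hv k) (norm_nonneg _))
    obtain ⟨a, ha, ha'⟩ := (isCompact_closedBall (0 : ℂ) (C * ‖f‖)).ultrafilter_le_nhds
      (U.map fun k => f (v k)) (by
        rw [le_principal_iff]
        exact Eventually.of_forall (f := (U : Filter ℕ)) hK)
    exact ⟨a, by simpa using ha, ha'⟩
  choose L hL hL' using h1
  refine ⟨LinearMap.mkContinuous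
    { toFun := L
      map_add' := fun f g => tendsto_nhds_unique (hL' (f + g)) ((hL' f).add (hL' g))
      map_smul' := fun c f => tendsto_nhds_unique (hL' (c • f)) ((hL' f).const_mul c) } C hL, hL'⟩

theorem norm_le_of_eventually_norm_le {v : ℕ → X} {F : Filter ℕ} [F.NeBot]
    {Φ : NDual (NDual X)} (hΦ : ∀ f : NDual X, Tendsto (fun k => f (v k)) F (𝓝 (Φ f))) {c : ℝ}
    (hc : ∀ᶠ k in F, ‖v k‖ ≤ c) : ‖Φ‖ ≤ c := by
  obtain ⟨k, hk⟩ := hc.exists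
  refine Φ.opNorm_le_bound ((norm_nonneg _).trans hk) fun f => le_of_tendsto (hΦ f).norm ?_
  filter_upwards [hc] with k hk
  rw [mul_comm]
  exact (f.le_opNorm _).trans (mul_le_mul_of_nonneg_left hk (norm_nonneg _))

/-- The working form of the hypothesis that `X` is L-embedded. -/
theorem IsLEmbedded.exists_proj (hX : IsLEmbedded X) :
    ∃ P : NDual (NDual X) →L[ℂ] NDual (NDual X), (∀ Φ, ‖Φ‖ = ‖P Φ‖ + ‖Φ - P Φ‖) ∧
      (∀ x, P (ι X x) = ι X x) ∧ ∀ Φ, ∃ x, P Φ = ι X x := by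
  obtain ⟨P, hP, hr⟩ := hX
  refine ⟨P, fun Φ => ?_, fun x => ?_, fun Φ => ?_⟩
  · simpa using! hP.Lnorm Φ
  · have h1 : ι X x ∈ LinearMap.range (P : NDual (NDual X) →ₗ[ℂ] NDual (NDual X)) := by
      rw [hr]
      exact ⟨x, rfl⟩
    obtain ⟨Ψ, hΨ⟩ := h1
    rw [← hΨ]
    exact congrArg (fun Q : NDual (NDual X) →L[ℂ] NDual (NDual X) => Q Ψ) hP.proj
  · have h1 : P Φ ∈ canonicalCopy X := by
      rw [← hr]
      exact ⟨Φ, rfl⟩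
    obtain ⟨x, hx⟩ := h1
    exact ⟨x, hx.symm⟩

namespace SchauderBasis

variable {b : SchauderBasis ℂ X} {δ : ℕ → ℝ}

/-- An element of the bidual vanishing at the coordinate functionals. -/
def Annihilates (b : SchauderBasis ℂ X) (Φ : NDual (NDual X)) : Prop :=
  ∀ n, Φ (b.unitCoord n) = 0

/-- Finitely many values of a functional are invisible to `Φ`. This leaves freedom to prescribe them
so as to norm a given vector of `X` as well. -/
theorem Annihilates.apply_eq (hb : ∀ n, b n ≠ 0) {Φ : NDual (NDual X)} (hΦ : b.Annihilates Φ)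
    {M : ℕ} {F G : NDual X} (h : ∀ n ≥ M, F (b.unitVec n) = G (b.unitVec n)) : Φ F = Φ G := by
  rw [eq_add_sum_of_eq_tail hb h, map_add, map_sum, add_eq_left]
  exact Finset.sum_eq_zero fun i _ => by rw [map_smul, hΦ i, smul_zero]

namespace IsAlmostL1

variable (h : b.IsAlmostL1 δ)
include h

theorem annihilates_iff {Φ : NDual (NDual X)} :
    b.Annihilates Φ ↔ ∀ z ∈ b.coordSpan, Φ z = 0 := by
  refine ⟨fun hΦ z hz => ?_, fun hΦ n => hΦ _ (subset_closure (b.unitCoord_mem_span n))⟩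
  have h1 : b.coordSpan ≤ LinearMap.ker (Φ : NDual X →ₗ[ℂ] ℂ) := by
    refine Submodule.topologicalClosure_minimal _ (Submodule.span_le.2 ?_) Φ.isClosed_ker
    rintro _ ⟨n, rfl⟩
    have h2 := hΦ n
    rw [unitCoord, map_smul, smul_eq_mul, mul_eq_zero] at h2
    exact h2.resolve_left (by simpa using h.ne_zero n)
  exact h1 hz

variable [CompleteSpace X]

/-- Functionals annihilating the coordinates and tails of `X` are almost in `ℓ¹`-position. -/
theorem mul_norm_add_norm_le {Φ : NDual (NDual X)} (hΦ : b.Annihilates Φ) {m : ℕ} {w : X}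
    (hw : w ∈ b.tail m) : (1 - δ m) * (‖Φ‖ + ‖w‖) ≤ ‖Φ + ι X w‖ := by
  have hd := h.one_sub_pos m
  -- Truncating `w` leaves finitely many coordinates to adjust; the limit in `M` is taken at the
  -- end.
  have key : ∀ M, (1 - δ m) * (‖Φ‖ + ‖b.proj M w‖) ≤ ‖Φ + ι X (b.proj M w)‖ := by
    intro M
    set w' := b.proj M w with hw'
    have hc : ∀ n, b.unitCoord n w' = if n < M then b.unitCoord n w else 0 := fun n =>
      unitCoord_proj h.ne_zero M n w
    refine le_of_forall_pos_le_add fun ε hε => ?_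
    obtain ⟨f, hf, hf'⟩ := exists_re_apply_gt Φ hε
    -- Below `M` this `G` norms `w'`; from `M` on it copies `f`, which almost norms `Φ`.
    obtain ⟨G, hG, hG'⟩ := h.exists_functional m
      (g := fun n => if n < M then conjPhase (b.unitCoord n w) else f (b.unitVec n)) (fun n => by
        split_ifs
        · exact norm_conjPhase_le _
        · refine (f.le_opNorm _).trans ?_
          rwa [h.norm_unitVec, mul_one])
    have h1 : Φ G = (1 - δ m : ℝ) * Φ f := by
      rw [← smul_eq_mul, ← map_smul]
      refine hΦ.apply_eq h.ne_zero (M := max m M) fun n hn => ?_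
      rw [hG' n (le_of_max_le_left hn), if_neg (not_lt.2 (le_of_max_le_right hn))]
      simp
    have h2 : G w' = ((1 - δ m) * b.l1Norm w' : ℝ) := by
      refine (h.hasSum_apply G w').unique ?_
      have h3 := (h.summable w').hasSum.mul_left (1 - δ m)
      have h4 : ∀ n, b.unitCoord n w' * G (b.unitVec n) =
          (((1 - δ m) * ‖b.unitCoord n w'‖ : ℝ) : ℂ) := by
        intro n
        rw [hc]
        split_ifs with hn
        · rcases lt_or_ge n m with hnm | hnm
          · simp [hw n hnm]
          · rw [hG' n hnm, if_pos hn, mul_left_comm, conjPhase_mul, Complex.ofReal_mul]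
        · simp
      simp_rw [h4]
      exact Complex.hasSum_ofReal.2 h3
    have h4 : ((Φ + ι X w') G).re ≤ ‖Φ + ι X w'‖ :=
      (Complex.re_le_norm _).trans (((Φ + ι X w').le_opNorm G).trans
        (mul_le_of_le_one_right (norm_nonneg _) hG))
    rw [add_apply, NormedSpace.dual_def, h1, h2, Complex.add_re, Complex.re_ofReal_mul,
      Complex.ofReal_re] at h4
    have h5 := h.norm_le_l1Norm w'
    have h6 := (h.null.1 m).1
    nlinarith
  have ht := b.tendsto_proj w
  refine le_of_tendsto_of_tendsto' ((ht.norm.const_add _).const_mul _)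
    ((((ι X).continuous.tendsto _).comp ht).const_add Φ).norm key

end IsAlmostL1

end SchauderBasis

end Bidual

/-! ### The kernel of the L-projection, and `ℓ¹`-position of far tails. -/

section Bidual

variable {X : Type*} [NormedAddCommGroup X] [NormedSpace ℂ X]

local notation "ι" => NormedSpace.inclusionInDoubleDual ℂ

namespace SchauderBasis

variable {b : SchauderBasis ℂ X} {δ : ℕ → ℝ}

namespace IsAlmostL1

variable (h : b.IsAlmostL1 δ) [CompleteSpace X]
include h

/-- A functional annihilating the coordinates has `0` as a best approximation in `X`. -/
theorem norm_le_norm_sub {Φ : NDual (NDual X)} (hΦ : b.Annihilates Φ) (y : X) :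
    ‖Φ‖ ≤ ‖Φ - ι X y‖ := by
  classical
  set Ψ := Φ - ι X y with hΨ
  have key : ∀ m, (1 - δ m) * (2 * ‖Φ‖) ≤ 2 * ‖Ψ‖ := by
    intro m
    refine le_of_forall_pos_le_add fun ε' hε' => ?_
    obtain ⟨ε, hε, rfl⟩ : ∃ ε : ℝ, 0 < ε ∧ ε' = 4 * ε := ⟨ε' / 4, by positivity, by ring⟩
    obtain ⟨f, hf, hf'⟩ := exists_re_apply_gt Φ hε
    have hm : (0 : ℝ) < m + 1 := by positivity
    -- Then `w = y + s` is close to `Φ` at `f` and at the first `m` coordinates. So `‖w‖` is almost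
    -- at least `‖Φ‖`, and `w` is almost in the tail, because `Φ` vanishes at the coordinates.
    obtain ⟨s, hs, hs'⟩ := exists_norm_le_forall_apply_near Ψ
      (insert f ((Finset.range m).image b.unitCoord)) (div_pos hε hm)
    have hem : ε / (m + 1) ≤ ε := div_le_self hε.le (by linarith [m.cast_nonneg (α := ℝ)])
    set w := y + s with hw
    have h1 : ‖f w - Φ f‖ < ε := by
      have h2 := hs' f (Finset.mem_insert_self _ _)
      have h3 : f w - Φ f = f s - Ψ f := by
        simp [hw, hΨ]
        ring
      rw [h3]
      exact h2.trans_le hem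
    have h2 : ‖Φ‖ - 2 * ε ≤ ‖w‖ := by
      have h3 : ‖f w‖ ≤ ‖w‖ := (f.le_opNorm w).trans (mul_le_of_le_one_left (norm_nonneg _) hf)
      have h4 : ‖Φ f‖ ≤ ‖f w‖ + ‖f w - Φ f‖ := by
        rw [norm_sub_rev]
        simpa using norm_add_le (f w) (Φ f - f w)
      linarith [Complex.re_le_norm (Φ f)]
    have h5 : ‖b.proj m w‖ ≤ ε := by
      have h6 : ∀ i ∈ Finset.range m, ‖b.unitCoord i w • b.unitVec i‖ ≤ ε / (m + 1) := by
        intro i hi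
        have h7 := hs' (b.unitCoord i) (Finset.mem_insert_of_mem (Finset.mem_image_of_mem _ hi))
        rw [norm_smul, h.norm_unitVec, mul_one]
        have h8 : b.unitCoord i w = b.unitCoord i s - Ψ (b.unitCoord i) := by
          simp [hw, hΨ, hΦ i]
          ring
        rw [h8]
        exact h7.le
      rw [proj_eq_sum h.ne_zero]
      refine (norm_sum_le_of_le _ h6).trans ?_
      rw [Finset.sum_const, Finset.card_range, nsmul_eq_mul, mul_div_assoc', div_le_iff₀ hm]
      nlinarith
    -- The sign makes `Φ - w` equal to `Ψ - s`, whose norm is at most `2 * ‖Ψ‖`, while the lower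
    -- bound is about `2 * ‖Φ‖`.
    have h9 := h.mul_norm_add_norm_le hΦ (m := m) (w := -(w - b.proj m w))
      (Submodule.neg_mem _ (sub_proj_mem_tail h.ne_zero m w))
    have h10 : Φ + ι X (-(w - b.proj m w)) = Ψ - ι X s + ι X (b.proj m w) := by
      rw [← sub_eq_zero]
      simp only [hw, hΨ, map_neg, map_sub, map_add]
      abel
    have h11 : ‖Ψ - ι X s + ι X (b.proj m w)‖ ≤ ‖Ψ‖ + ‖s‖ + ‖b.proj m w‖ := by
      refine (norm_add_le _ _).trans (add_le_add ((norm_sub_le _ _).trans_eq ?_) ?_)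
      · rw [norm_inclusionInDoubleDual]
      · rw [norm_inclusionInDoubleDual]
    rw [h10, norm_neg] at h9
    have h12 : ‖w‖ - ‖b.proj m w‖ ≤ ‖w - b.proj m w‖ := norm_sub_norm_le _ _
    have h13 := h.one_sub_pos m
    have h14 := (h.null.1 m).1
    have h15 : (1 - δ m) * (2 * ‖Φ‖ - 3 * ε) ≤ (1 - δ m) * (‖Φ‖ + ‖w - b.proj m w‖) :=
      mul_le_mul_of_nonneg_left (by linarith) h13.le
    nlinarith
  have h1 : Tendsto (fun m => (1 - δ m) * (2 * ‖Φ‖)) atTop (𝓝 ((1 - 0) * (2 * ‖Φ‖))) :=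
    (h.null.2.const_sub 1).mul_const _
  linarith [le_of_tendsto' h1 key]

/-- Every element of the bidual is the sum of a vector of `X` and a functional annihilating the
coordinates. -/
theorem exists_annihilates_sub (Φ : NDual (NDual X)) : ∃ y : X, b.Annihilates (Φ - ι X y) := by
  obtain ⟨y, hy⟩ := h.exists_vector (a := fun n => Φ (b.unitCoord n)) (by
    refine summable_of_sum_range_le (c := ‖Φ‖ * (1 * (1 - δ 0)⁻¹)) (fun _ => norm_nonneg _)
      fun n => ?_
    -- Aligning the phases makes `Φ f` the partial sum itself, while `‖f‖` is bounded independently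
    -- of `n`.
    set f : NDual X := ∑ i ∈ Finset.range n, conjPhase (Φ (b.unitCoord i)) • b.unitCoord i with hf
    have h1 : Φ f = ((∑ i ∈ Finset.range n, ‖Φ (b.unitCoord i)‖ : ℝ) : ℂ) := by
      rw [hf, map_sum, Complex.ofReal_sum]
      refine Finset.sum_congr rfl fun i _ => ?_
      rw [map_smul, smul_eq_mul, mul_comm, conjPhase_mul]
    have h2 : ‖f‖ ≤ 1 * (1 - δ 0)⁻¹ := h.norm_functional_le fun k => by
      have h3 : f (b.unitVec k) = if k < n then conjPhase (Φ (b.unitCoord k)) else 0 := by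
        simp [hf, _root_.sum_apply, unitCoord_unitVec h.ne_zero]
      rw [h3]
      split_ifs
      · exact norm_conjPhase_le _
      · simp
    have h3 := (Complex.re_le_norm _).trans (Φ.le_opNorm f)
    rw [h1, Complex.ofReal_re] at h3
    exact h3.trans (mul_le_mul_of_nonneg_left h2 (norm_nonneg _)))
  exact ⟨y, fun n => by simp [hy]⟩

/-- The L-projection of the bidual onto `X` has the annihilator of the coordinates as its
kernel. -/
theorem exists_lprojection (hX : IsLEmbedded X) :
    ∃ P : NDual (NDual X) →L[ℂ] NDual (NDual X), (∀ Φ, ‖Φ‖ = ‖P Φ‖ + ‖Φ - P Φ‖) ∧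
      (∀ x, P (ι X x) = ι X x) ∧ (∀ Φ, b.Annihilates Φ → P Φ = 0) ∧
      ∀ Φ, ∃ x, P Φ = ι X x ∧ b.Annihilates (Φ - ι X x) := by
  obtain ⟨P, h1, h2, h3⟩ := hX.exists_proj
  -- If `P Φ` is the vector `y`, then `‖Φ‖ = ‖y‖ + ‖Φ - y‖ ≥ ‖y‖ + ‖Φ‖`, which forces `y = 0`.
  have h4 : ∀ Φ, b.Annihilates Φ → P Φ = 0 := fun Φ hΦ => by
    obtain ⟨y, hy⟩ := h3 Φ
    have h5 := h1 Φ
    have h6 := h.norm_le_norm_sub hΦ y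
    rw [← hy] at h6
    exact norm_le_zero_iff.1 (by linarith)
  refine ⟨P, h1, h2, h4, fun Φ => ?_⟩
  obtain ⟨y, hy⟩ := h.exists_annihilates_sub Φ
  refine ⟨y, ?_, hy⟩
  rw [← sub_eq_zero, ← h2 y, ← map_sub]
  exact h4 _ hy

/-- The main use of L-embeddedness: `Φ` lies in the kernel of the L-projection and `y` in its range.
-/
theorem norm_add_of_annihilates (hX : IsLEmbedded X) {Φ : NDual (NDual X)}
    (hΦ : b.Annihilates Φ) (y : X) : ‖Φ + ι X y‖ = ‖Φ‖ + ‖y‖ := by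
  obtain ⟨P, h1, h2, h3, -⟩ := h.exists_lprojection hX
  have h4 := h1 (Φ + ι X y)
  rwa [map_add, h3 Φ hΦ, h2, zero_add, add_sub_cancel_right, norm_inclusionInDoubleDual,
    add_comm ‖y‖] at h4

/-- A sequence of successive disjoint blocks is almost normed by a single functional. -/
theorem exists_functional_of_blocks {u : ℕ → X} {a : ℕ → ℕ} (ha : StrictMono a)
    (hu : ∀ k n, b.unitCoord n (u k) ≠ 0 → a k ≤ n ∧ n < a (k + 1)) (m : ℕ) :
    ∃ G : NDual X, ‖G‖ ≤ 1 ∧ ∀ k, m ≤ k → G (u k) = ((1 - δ m) * b.l1Norm (u k) : ℝ) := by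
  classical
  -- An index lies in at most one interval `[a k, a (k + 1))`, so the phases for all blocks can be
  -- prescribed at once.
  obtain ⟨G, hG, hG'⟩ := h.exists_functional m
    (g := fun n => if H : ∃ k, a k ≤ n ∧ n < a (k + 1) then conjPhase (b.unitCoord n (u H.choose))
      else 0) (fun n => by
        split_ifs
        · exact norm_conjPhase_le _
        · simp)
  refine ⟨G, hG, fun k hk => (h.hasSum_apply G (u k)).unique ?_⟩
  have h4 : ∀ n, b.unitCoord n (u k) * G (b.unitVec n) =
      (((1 - δ m) * ‖b.unitCoord n (u k)‖ : ℝ) : ℂ) := by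
    intro n
    by_cases hn : b.unitCoord n (u k) = 0
    · simp [hn]
    · have h5 := hu k n hn
      have H : ∃ k, a k ≤ n ∧ n < a (k + 1) := ⟨k, h5⟩
      have h6 : H.choose = k := by
        have h7 := H.choose_spec
        have h8 := ha.lt_iff_lt.1 (h7.1.trans_lt h5.2)
        have h9 := ha.lt_iff_lt.1 (h5.1.trans_lt h7.2)
        omega
      rw [hG' n ((hk.trans (ha.id_le k)).trans h5.1), dif_pos H, h6, mul_left_comm, conjPhase_mul,
        Complex.ofReal_mul]
  simp_rw [h4]
  exact Complex.hasSum_ofReal.2 ((h.summable (u k)).hasSum.mul_left (1 - δ m))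

/-- A fixed vector and a far tail are almost in `ℓ¹`-position. -/
theorem exists_tail_mul_le (hX : IsLEmbedded X) (y : X) {ε : ℝ} (hε : 0 < ε) :
    ∃ m, ∀ v ∈ b.tail m, (1 - ε) * (‖y‖ + ‖v‖) ≤ ‖y + v‖ := by
  by_contra! H
  have h1 : ∀ m, ∃ v ∈ b.tail m, ∃ M, m < M ∧ (∀ n, M ≤ n → b.unitCoord n v = 0) ∧
      ‖y + v‖ < (1 - ε) * (‖y‖ + ‖v‖) := by
    intro m
    obtain ⟨v, hv, hv'⟩ := H m
    have ht := b.tendsto_proj v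
    -- The strict inequality survives truncation, so counterexamples may be taken finitely supported
    -- and arranged in successive blocks.
    have h2 := ((ht.const_add y).norm).eventually_lt ((ht.norm.const_add ‖y‖).const_mul (1 - ε)) hv'
    obtain ⟨M, hM, hM'⟩ := (h2.and (eventually_gt_atTop m)).exists
    refine ⟨b.proj M v, fun n hn => ?_, M, hM', fun n hn => ?_, hM⟩
    · rw [unitCoord_proj h.ne_zero, hv n hn, ite_self]
    · rw [unitCoord_proj h.ne_zero, if_neg (not_lt.2 hn)]
  choose v hv M hM hM' hlt using h1
  let a : ℕ → ℕ := fun k => M^[k] 0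
  have ha' : ∀ k, a (k + 1) = M (a k) := fun k => Function.iterate_succ_apply' M k 0
  have ha : StrictMono a := strictMono_nat_of_lt_succ fun k => by
    rw [ha']
    exact hM _
  let u : ℕ → X := fun k => v (a k)
  have hu : ∀ k n, b.unitCoord n (u k) ≠ 0 → a k ≤ n ∧ n < a (k + 1) := by
    intro k n hn
    refine ⟨not_lt.1 fun h2 => hn (hv (a k) n h2), not_le.1 fun h2 => hn (hM' (a k) n ?_)⟩
    rwa [ha'] at h2
  have hbd : ∀ k, ‖u k‖ ≤ 2 * ‖y‖ / ε := by
    intro k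
    rw [le_div_iff₀ hε]
    have h2 : ‖u k‖ - ‖y‖ ≤ ‖y + u k‖ := by
      rw [add_comm y]
      simpa using norm_sub_norm_le (u k) (-y)
    have h3 := hlt (a k)
    change ‖y + u k‖ < (1 - ε) * (‖y‖ + ‖u k‖) at h3
    nlinarith [norm_nonneg y, norm_nonneg (u k)]
  let U : Ultrafilter ℕ := hyperfilter ℕ
  have hU : (U : Filter ℕ) ≤ atTop := Nat.hyperfilter_le_atTop
  obtain ⟨Φ, hΦ⟩ := exists_ultrafilter_limit hbd U
  have hΦa : b.Annihilates Φ := fun n => by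
    refine tendsto_nhds_unique (hΦ (b.unitCoord n)) (tendsto_const_nhds.congr' ?_)
    filter_upwards [hU (eventually_gt_atTop n)] with k hk
    by_contra h2
    have := (hu k n (Ne.symm h2)).1
    have h3 := ha.id_le k
    simp only [id] at h3
    omega
  obtain ⟨L, hL⟩ : ∃ L : ℝ, Tendsto (fun k => ‖u k‖) U (𝓝 L) := by
    obtain ⟨L, -, hL⟩ := (isCompact_Icc (a := (0 : ℝ)) (b := 2 * ‖y‖ / ε)).ultrafilter_le_nhds
      (U.map fun k => ‖u k‖) (by
        rw [le_principal_iff]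
        exact Eventually.of_forall (f := (U : Filter ℕ)) fun k => ⟨norm_nonneg _, hbd k⟩)
    exact ⟨L, hL⟩
  -- Passing to a weak* limit does not lose norm here: a single functional almost norms all late
  -- blocks.
  have hLΦ : L ≤ ‖Φ‖ := by
    have h2 : ∀ m, (1 - δ m) * L ≤ ‖Φ‖ := by
      intro m
      obtain ⟨G, hG, hG'⟩ := h.exists_functional_of_blocks ha hu m
      have h3 : ‖Φ G‖ ≤ ‖Φ‖ := (Φ.le_opNorm G).trans (mul_le_of_le_one_right (norm_nonneg _) hG)
      refine le_trans (le_of_tendsto_of_tendsto (hL.const_mul _) (hΦ G).norm ?_) h3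
      filter_upwards [hU (eventually_ge_atTop m)] with k hk
      rw [hG' k hk, Complex.norm_real, Real.norm_of_nonneg
        (mul_nonneg (h.one_sub_pos m).le (l1Norm_nonneg _))]
      exact mul_le_mul_of_nonneg_left (h.norm_le_l1Norm _) (h.one_sub_pos m).le
    have h3 : Tendsto (fun m => (1 - δ m) * L) atTop (𝓝 ((1 - 0) * L)) :=
      (h.null.2.const_sub 1).mul_const _
    linarith [le_of_tendsto' h3 h2]
  have hle : ‖Φ + ι X y‖ ≤ (1 - ε) * (‖y‖ + L) := by
    refine le_of_forall_pos_le_add fun η hη => ?_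
    refine norm_le_of_eventually_norm_le (v := fun k => u k + y) (F := (U : Filter ℕ))
      (fun f => ?_) ?_
    · simpa using (hΦ f).add_const (f y)
    · have h2 := ((hL.const_add ‖y‖).const_mul (1 - ε)).eventually_lt_const
        (lt_add_of_pos_right _ hη)
      filter_upwards [h2] with k hk
      rw [add_comm]
      exact ((hlt (a k)).trans hk).le
  -- Now `‖y‖ + L ≤ (1 - ε) * (‖y‖ + L)`, so `y = 0`, in which case the assumed inequality is
  -- absurd.
  rw [h.norm_add_of_annihilates hX hΦa] at hle
  have hL0 : 0 ≤ L := ge_of_tendsto' hL fun k => norm_nonneg _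
  have hy0 : ‖y‖ = 0 := by nlinarith [norm_nonneg y]
  have h2 := hlt 0
  rw [norm_eq_zero.1 hy0, norm_zero, zero_add, zero_add] at h2
  nlinarith [norm_nonneg (v 0)]

/-- A finite-dimensional subspace and a far tail are almost in `ℓ¹`-position. -/
theorem exists_tail_mul_le_of_finiteDimensional (hX : IsLEmbedded X) (F : Submodule ℂ X)
    [FiniteDimensional ℂ F] {ε : ℝ} (hε : 0 < ε) :
    ∃ m, ∀ y ∈ F, ∀ v ∈ b.tail m, (1 - ε) * (‖y‖ + ‖v‖) ≤ ‖y + v‖ := by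
  have hK : IsCompact (Metric.sphere (0 : F) 1) := isCompact_sphere _ _
  have h1 : ∃ m, ∀ y ∈ Metric.sphere (0 : F) 1, ∀ v ∈ b.tail m,
      (1 - ε) * (1 + ‖v‖) ≤ ‖(y : X) + v‖ := by
    -- Compactness of the unit sphere of `F`: each point is treated with `ε / 2`, and the other half
    -- absorbs moving within a ball of radius `ε / 2`.
    refine hK.induction_on (p := fun s => ∃ m, ∀ y ∈ s, ∀ v ∈ b.tail m,
      (1 - ε) * (1 + ‖v‖) ≤ ‖(y : X) + v‖) ⟨0, by simp⟩ ?_ ?_ ?_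
    · rintro s t hst ⟨m, hm⟩
      exact ⟨m, fun y hy => hm y (hst hy)⟩
    · rintro s t ⟨m, hm⟩ ⟨m', hm'⟩
      refine ⟨max m m', fun y hy v hv => hy.elim (fun hy => hm y hy v ?_) fun hy => hm' y hy v ?_⟩
      · exact tail_anti (le_max_left _ _) hv
      · exact tail_anti (le_max_right _ _) hv
    · intro y hy
      obtain ⟨m, hm⟩ := h.exists_tail_mul_le hX (y : X) (half_pos hε)
      refine ⟨_, mem_nhdsWithin_of_mem_nhds (Metric.ball_mem_nhds y (half_pos hε)), m,
        fun z hz v hv => ?_⟩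
      have h2 := hm v hv
      have hy1 : ‖(y : X)‖ = 1 := by simpa using hy
      have h3 : ‖(y : X) + v‖ ≤ ‖(z : X) + v‖ + ‖(y : X) - z‖ := by
        have := norm_add_le ((z : X) + v) ((y : X) - z)
        rwa [show (z : X) + v + (y - z) = y + v by abel] at this
      have h4 : ‖(y : X) - z‖ < ε / 2 := by
        rw [Metric.mem_ball, dist_comm, dist_eq_norm] at hz
        exact hz
      rw [hy1] at h2
      nlinarith [norm_nonneg v]
  obtain ⟨m, hm⟩ := h1
  refine ⟨m, fun y hy v hv => ?_⟩
  rcases eq_or_ne y 0 with rfl | hy0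
  · simp only [norm_zero, zero_add]
    nlinarith [norm_nonneg v]
  · have hn : 0 < ‖y‖ := norm_pos_iff.2 hy0
    have hn' : (‖y‖ : ℂ) ≠ 0 := by simpa using hy0
    let z : F := ⟨((‖y‖ : ℂ)⁻¹) • y, F.smul_mem _ hy⟩
    have h2 := hm z (by simp [z, norm_smul, hn.ne']) (((‖y‖ : ℂ)⁻¹) • v) ((b.tail m).smul_mem _ hv)
    change _ ≤ ‖(‖y‖ : ℂ)⁻¹ • y + (‖y‖ : ℂ)⁻¹ • v‖ at h2
    rw [← smul_add, norm_smul, norm_smul, norm_inv, Complex.norm_real, norm_norm] at h2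
    have h3 := mul_le_mul_of_nonneg_left h2 hn.le
    rw [mul_inv_cancel_left₀ hn.ne'] at h3
    calc (1 - ε) * (‖y‖ + ‖v‖) = ‖y‖ * ((1 - ε) * (1 + ‖y‖⁻¹ * ‖v‖)) := by field_simp
      _ ≤ _ := h3

end IsAlmostL1

end SchauderBasis

end Bidual

/-! ### Sequences spanning `ℓ¹` asymptotically, and uniform tail estimates. -/

section Sequences

variable {X : Type*} [NormedAddCommGroup X] [NormedSpace ℂ X]

/-- Choosing `δ m` within `1 / (m + 1)` of the infimum of the admissible values turns an estimate
for each fixed `ε` into one with a null sequence. -/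
theorem exists_isNullSeq {p : ℕ → ℝ → Prop} (h0 : ∀ m, ∃ ε, 0 ≤ ε ∧ ε < 1 ∧ p m ε)
    (hp : ∀ ε > 0, ε < 1 → ∀ᶠ m in atTop, p m ε) : ∃ δ, IsNullSeq δ ∧ ∀ m, p m (δ m) := by
  let A : ℕ → Set ℝ := fun m => {ε | 0 ≤ ε ∧ ε < 1 ∧ p m ε}
  have hA : ∀ m, BddBelow (A m) := fun m => ⟨0, fun ε hε => hε.1⟩
  have h1 : ∀ m, ∃ ε ∈ A m, ε < sInf (A m) + 1 / ((m : ℝ) + 1) := fun m =>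
    exists_lt_of_csInf_lt (h0 m) (lt_add_of_pos_right _ (by positivity))
  choose δ hδ hδ' using h1
  refine ⟨δ, ⟨fun n => ⟨(hδ n).1, (hδ n).2.1⟩, ?_⟩, fun m => (hδ m).2.2⟩
  rw [Metric.tendsto_atTop']
  intro ε hε
  have hε' : 0 < min (ε / 2) (1 / 2) := by positivity
  have h2 := hp _ hε' ((min_le_right _ _).trans_lt (by norm_num))
  have h3 := (tendsto_one_div_add_atTop_nhds_zero_nat (𝕜 := ℝ)).eventually_lt_const
    (half_pos hε)
  obtain ⟨N, hN⟩ := eventually_atTop.1 (h2.and h3)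
  refine ⟨N, fun n hn => ?_⟩
  obtain ⟨h4, h5⟩ := hN n hn.le
  have h6 : sInf (A n) ≤ min (ε / 2) (1 / 2) :=
    csInf_le (hA n) ⟨hε'.le, (min_le_right _ _).trans_lt (by norm_num), h4⟩
  rw [dist_zero_right, Real.norm_of_nonneg (hδ n).1]
  linarith [hδ' n, min_le_left (ε / 2) (1 / 2)]

/-- A sequence of unit vectors, each almost in `ℓ¹`-position to the span of the preceding ones,
spans `ℓ¹` asymptotically. -/
theorem spansL1Asymp_of_step {u : ℕ → X} (hu : ∀ n, u n ≠ 0) {c : ℕ → ℝ} (hc : ∀ n, 1 ≤ c n)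
    (hc' : Tendsto c atTop (𝓝 1))
    (h : ∀ n, ∀ y ∈ Submodule.span ℂ ((fun i => normalize' (u i)) '' Set.Iio n), ∀ a : ℂ,
      c (n + 1) / c n * (‖y‖ + ‖a‖) ≤ ‖y + a • normalize' (u n)‖) : SpansL1Asymp u := by
  have hpos : ∀ n, 0 < c n := fun n => zero_lt_one.trans_le (hc n)
  refine ⟨hu, fun n => 1 - (c n)⁻¹, ⟨fun n => ⟨?_, ?_⟩, ?_⟩, fun s α =>
    ⟨?_, norm_sum_smul_normalize'_le u s α⟩⟩
  · linarith [inv_le_one_of_one_le₀ (hc n)]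
  · linarith [inv_pos.2 (hpos n)]
  · simpa using (hc'.inv₀ one_ne_zero).const_sub 1
  -- The losses telescope: after `N` steps the `n`-th coefficient has weight `c N / c n`, which is
  -- at least `(c n)⁻¹` since `1 ≤ c N`.
  have key : ∀ (β : ℕ → ℂ) (N : ℕ), ∑ n ∈ Finset.range N, c N / c n * ‖β n‖ ≤
      ‖∑ n ∈ Finset.range N, β n • normalize' (u n)‖ := by
    intro β N
    induction N with
    | zero => simp
    | succ N ih =>
      rw [Finset.sum_range_succ, Finset.sum_range_succ]
      refine le_trans ?_ (h N _ (Submodule.sum_mem _ fun i hi => Submodule.smul_mem _ _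
        (Submodule.subset_span ⟨i, Finset.mem_range.1 hi, rfl⟩)) _)
      rw [mul_add]
      refine add_le_add ?_ le_rfl
      refine le_trans (le_of_eq ?_) (mul_le_mul_of_nonneg_left ih
        (div_nonneg (hpos _).le (hpos _).le))
      rw [Finset.mul_sum]
      refine Finset.sum_congr rfl fun i _ => ?_
      rw [← mul_assoc, div_mul_div_cancel₀ (hpos N).ne']
  obtain ⟨N, hN⟩ := s.exists_nat_subset_range
  have h1 := key (fun n => if n ∈ s then α n else 0) N
  have h2 : ∑ n ∈ Finset.range N, (if n ∈ s then α n else 0) • normalize' (u n) =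
      ∑ n ∈ s, α n • normalize' (u n) := by
    rw [← Finset.sum_subset hN fun n _ hn => by simp [hn]]
    exact Finset.sum_congr rfl fun n hn => by rw [if_pos hn]
  have h3 : ∑ n ∈ Finset.range N, c N / c n * ‖if n ∈ s then α n else 0‖ =
      ∑ n ∈ s, c N / c n * ‖α n‖ := by
    rw [← Finset.sum_subset hN fun n _ hn => by simp [hn]]
    exact Finset.sum_congr rfl fun n hn => by rw [if_pos hn]
  rw [h2, h3] at h1
  refine le_trans (Finset.sum_le_sum fun n _ => mul_le_mul_of_nonneg_right ?_ (norm_nonneg _)) h1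
  rw [sub_sub_cancel, ← one_div]
  exact div_le_div_of_nonneg_right (hc N) (hpos n).le

namespace SchauderBasis

variable {b : SchauderBasis ℂ X} {δ : ℕ → ℝ}

namespace IsAlmostL1

variable (h : b.IsAlmostL1 δ)
include h

theorem tendsto_proj_of_coord {F : Filter ℕ} {v : ℕ → X}
    (hv : ∀ n, Tendsto (fun k => b.unitCoord n (v k)) F (𝓝 0)) (m : ℕ) :
    Tendsto (fun k => ‖b.proj m (v k)‖) F (𝓝 0) := by
  simp_rw [proj_eq_sum h.ne_zero]
  have h1 := (tendsto_finsetSum (Finset.range m) fun i _ => (hv i).smul_const (b.unitVec i)).norm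
  simpa using h1

variable [CompleteSpace X]

/-- Replacing `w` by its tail costs `‖b.proj m w‖` twice: once in `‖w‖` and once in `‖y + w‖`. The
error is negligible along coordinatewise null sequences. -/
theorem exists_mul_le_add_proj (hX : IsLEmbedded X) (F : Submodule ℂ X)
    [FiniteDimensional ℂ F] {ε : ℝ} (hε : 0 < ε) (hε' : ε ≤ 1) :
    ∃ m, ∀ y ∈ F, ∀ w, (1 - ε) * (‖y‖ + ‖w‖) ≤ ‖y + w‖ + 2 * ‖b.proj m w‖ := by
  obtain ⟨m, hm⟩ := h.exists_tail_mul_le_of_finiteDimensional hX F hε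
  refine ⟨m, fun y hy w => ?_⟩
  have h1 := hm y hy _ (sub_proj_mem_tail h.ne_zero m w)
  have h2 : ‖w‖ ≤ ‖w - b.proj m w‖ + ‖b.proj m w‖ := norm_le_norm_sub_add _ _
  have h3 : ‖y + (w - b.proj m w)‖ ≤ ‖y + w‖ + ‖b.proj m w‖ := by
    rw [← add_sub_assoc]
    exact norm_sub_le _ _
  nlinarith [norm_nonneg (b.proj m w)]

/-- The tails are asymptotically contractively embedded in `ℓ¹`. -/
theorem eventually_mul_l1Norm_sub_proj_le (hX : IsLEmbedded X) {ε : ℝ} (hε : 0 < ε)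
    (hε1 : ε < 1) : ∀ᶠ m in atTop, ∀ x, (1 - ε) * b.l1Norm (x - b.proj m x) ≤ ‖x‖ := by
  obtain ⟨η, hη, rfl⟩ : ∃ η : ℝ, 0 < η ∧ ε = 3 * η := ⟨ε / 3, by positivity, by ring⟩
  have hf : ∀ j, ∃ m, j ≤ m ∧ ∀ x, ∀ v ∈ b.tail m,
      (1 - η) * (‖b.proj j x‖ + ‖v‖) ≤ ‖b.proj j x + v‖ := by
    intro j
    have : FiniteDimensional ℂ (LinearMap.range (b.proj j : X →ₗ[ℂ] X)) := by
      rw [range_proj_eq_span]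
      exact FiniteDimensional.span_of_finite ℂ ((Finset.finite_toSet _).image _)
    obtain ⟨m, hm⟩ := h.exists_tail_mul_le_of_finiteDimensional hX
      (LinearMap.range (b.proj j : X →ₗ[ℂ] X)) hη
    exact ⟨max j m, le_max_left _ _, fun x v hv =>
      hm _ ⟨x, rfl⟩ v (tail_anti (le_max_right _ _) hv)⟩
  choose f hf hf' using hf
  -- Starting at `J` makes `(1 - η) * l1Norm` at most the norm on all tails used below.
  obtain ⟨J, hJ⟩ := (h.null.2.eventually_lt_const hη).exists
  let j : ℕ → ℕ := fun i => f^[i] J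
  have hj : ∀ i, j (i + 1) = f (j i) := fun i => Function.iterate_succ_apply' f i J
  have hjm : Monotone j := monotone_nat_of_le_succ fun i => by
    rw [hj]
    exact hf _
  have hd := h.one_sub_pos 0
  -- With this many disjoint intervals, every `x` has `ℓ¹`-mass at most `η * ‖x‖` on one of them.
  -- The interval depends on `x`, but the threshold `j K` does not.
  obtain ⟨K, hK⟩ := exists_nat_gt (η * (1 - δ 0))⁻¹
  have hK0 : (0 : ℝ) < K := lt_trans (by positivity) hK
  filter_upwards [eventually_ge_atTop (j K)] with m hm x
  let p : ℕ → ℝ := fun n => ∑ i ∈ Finset.range n, ‖b.unitCoord i x‖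
  have hN : b.l1Norm x ≤ K * (η * ‖x‖) := by
    have h1 := h.mul_l1Norm_le' x
    have h2 : 1 ≤ K * (η * (1 - δ 0)) := by
      rw [← div_le_iff₀ (by positivity), one_div]
      exact hK.le
    have h3 : 0 ≤ b.l1Norm x := l1Norm_nonneg x
    calc b.l1Norm x ≤ K * (η * (1 - δ 0)) * b.l1Norm x := le_mul_of_one_le_left h3 h2
      _ = K * (η * ((1 - δ 0) * b.l1Norm x)) := by ring
      _ ≤ _ := by gcongr
  obtain ⟨i, hi, hi'⟩ : ∃ i ∈ Finset.range K, p (j (i + 1)) - p (j i) ≤ η * ‖x‖ := by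
    refine Finset.exists_le_of_sum_le (Finset.nonempty_range_iff.2 fun h0 => ?_) ?_
    · simp [h0] at hK0
    · rw [Finset.sum_range_sub fun i => p (j i), Finset.sum_const, Finset.card_range, nsmul_eq_mul]
      have h1 : p (j K) ≤ b.l1Norm x := (h.summable x).sum_le_tsum _ fun _ _ => norm_nonneg _
      have h2 : 0 ≤ p (j 0) := Finset.sum_nonneg fun _ _ => norm_nonneg _
      linarith
  -- Removing the light interval splits `x`, up to `η * ‖x‖`, into a head and a tail separated by
  -- the gap from `j i` to `f (j i)`, hence almost in `ℓ¹`-position.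
  set v := x - b.proj (j (i + 1)) x with hv
  have hvt : v ∈ b.tail (j (i + 1)) := sub_proj_mem_tail h.ne_zero _ x
  have h1 := hf' (j i) x v (by rwa [← hj])
  have h2 : ‖b.proj (j i) x + v‖ ≤ ‖x‖ + η * ‖x‖ := by
    have h3 : ‖b.proj (j (i + 1)) x - b.proj (j i) x‖ ≤ η * ‖x‖ := by
      rw [proj_eq_sum h.ne_zero, proj_eq_sum h.ne_zero,
        ← Finset.sum_Ico_eq_sub _ (hjm i.le_succ)]
      refine (norm_sum_smul_normalize'_le b _ _).trans (le_trans (le_of_eq ?_) hi')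
      rw [Finset.sum_Ico_eq_sub _ (hjm i.le_succ)]
    have h4 : b.proj (j i) x + v = x - (b.proj (j (i + 1)) x - b.proj (j i) x) := by
      rw [hv]
      abel
    rw [h4]
    exact (norm_sub_le _ _).trans (by linarith)
  have h3 : (1 - η) * b.l1Norm v ≤ ‖v‖ := by
    refine le_trans (mul_le_mul_of_nonneg_right ?_ (l1Norm_nonneg v))
      (h.mul_l1Norm_le (tail_anti (hjm (Nat.zero_le (i + 1))) hvt))
    change 1 - η ≤ 1 - δ J
    linarith
  have h4 : b.l1Norm (x - b.proj m x) ≤ b.l1Norm v :=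
    h.l1Norm_sub_proj_anti ((hjm (Finset.mem_range.1 hi)).trans hm) x
  have h5 : (1 - η) * ((1 - η) * b.l1Norm v) ≤ (1 + η) * ‖x‖ := by
    have : (1 - η) * ((1 - η) * b.l1Norm v) ≤ (1 - η) * (‖b.proj (j i) x‖ + ‖v‖) :=
      mul_le_mul_of_nonneg_left (by linarith [norm_nonneg (b.proj (j i) x)]) (by linarith)
    linarith
  -- The choice `ε = 3 * η` works because `(1 + η) * (1 - 3 * η) ≤ (1 - η) ^ 2`.
  have h6 : (1 + η) * ((1 - 3 * η) * b.l1Norm v) ≤ (1 + η) * ‖x‖ := by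
    have h0 : 0 ≤ b.l1Norm v := l1Norm_nonneg v
    nlinarith [mul_nonneg (sq_nonneg η) h0]
  exact (mul_le_mul_of_nonneg_left h4 (by linarith)).trans (le_of_mul_le_mul_left h6 (by positivity))

/-- There is a null sequence controlling all the tails. -/
theorem exists_isNullSeq_l1Norm (hX : IsLEmbedded X) :
    ∃ γ, IsNullSeq γ ∧ ∀ m x, (1 - γ m) * b.l1Norm (x - b.proj m x) ≤ ‖x‖ :=
  exists_isNullSeq (p := fun m ε => ∀ x, (1 - ε) * b.l1Norm (x - b.proj m x) ≤ ‖x‖)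
    (fun m => ⟨δ 0, (h.null.1 0).1, (h.null.1 0).2, fun x =>
      (mul_le_mul_of_nonneg_left (h.l1Norm_sub_proj_le m x) (h.one_sub_pos 0).le).trans
        (h.mul_l1Norm_le' x)⟩) fun _ => h.eventually_mul_l1Norm_sub_proj_le hX

/-- Asymptotic `ℓ¹`-sequences are coordinatewise null. -/
theorem tendsto_coord_of_spansL1Asymp (hX : IsLEmbedded X) {u : ℕ → X} (hu : SpansL1Asymp u)
    (n : ℕ) : Tendsto (fun k => b.unitCoord n (normalize' (u k))) atTop (𝓝 0) := by
  obtain ⟨hu0, σ, hσ, hσ'⟩ := hu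
  by_contra hcon
  obtain ⟨s, hs, hs'⟩ := not_tendsto_iff_exists_frequently_notMem.1 hcon
  set w : ℕ → X := fun k => normalize' (u k) with hw
  have hw1 : ∀ k, ‖w k‖ = 1 := fun k => norm_normalize' (hu0 k)
  obtain ⟨U, hU, hUs⟩ : ∃ U : Ultrafilter ℕ, (U : Filter ℕ) ≤ atTop ∧
      ∀ᶠ k in (U : Filter ℕ), b.unitCoord n (w k) ∉ s := by
    have : (atTop ⊓ 𝓟 {k | b.unitCoord n (w k) ∉ s}).NeBot := frequently_mem_iff_neBot.1 hs'
    have h1 := Ultrafilter.of_le (atTop ⊓ 𝓟 {k | b.unitCoord n (w k) ∉ s})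
    exact ⟨_, h1.trans inf_le_left, le_principal_iff.1 (h1.trans inf_le_right)⟩
  obtain ⟨Φ, hΦ⟩ := exists_ultrafilter_limit (fun k => (hw1 k).le) U
  obtain ⟨y, hy⟩ := h.exists_annihilates_sub Φ
  have hlim : ∀ i, Tendsto (fun k => b.unitCoord i (w k)) U (𝓝 (b.unitCoord i y)) := by
    intro i
    have h1 := hy i
    rw [sub_apply, NormedSpace.dual_def, sub_eq_zero] at h1
    rw [← h1]
    exact hΦ _
  have hy0 : y ≠ 0 := by
    rintro rfl
    have h1 := hlim n
    rw [map_zero] at h1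
    obtain ⟨k, hk, hk'⟩ := ((h1.eventually hs).and hUs).exists
    exact hk' hk
  set θ := ‖y‖ with hθ
  have hθ0 : 0 < θ := norm_pos_iff.2 hy0
  obtain ⟨η, hη, hη1, hη2⟩ : ∃ η : ℝ, 0 < η ∧ 8 * η ≤ θ ∧ 8 * η ≤ 1 :=
    ⟨min θ 1 / 8, by positivity, by linarith [min_le_left θ 1], by linarith [min_le_right θ 1]⟩
  obtain ⟨m, hm⟩ := h.exists_mul_le_add_proj hX (Submodule.span ℂ {y}) hη (by linarith)
  have hproj := (h.tendsto_proj_of_coord (v := fun k => w k - y) (F := (U : Filter ℕ))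
    (fun i => by simpa using (hlim i).sub_const (b.unitCoord i y)) m).eventually_lt_const
      (half_pos hη)
  -- If the limit `y` were nonzero, then `y` and `w k - y` would be almost in `ℓ¹`-position, so `‖w
  -- k - y‖` would be near `1 - θ`. Two such vectors have distance at most `2 - θ`, against the
  -- lower bound `2 - σ k - σ l`.
  have hnear : ∀ᶠ k in (U : Filter ℕ), ‖w k - y‖ ≤ 1 - θ / 2 ∧ σ k < θ / 2 := by
    filter_upwards [hproj, hU (hσ.2.eventually_lt_const (half_pos hθ0))] with k hk hk'
    refine ⟨?_, hk'⟩
    have h1 := hm y (Submodule.mem_span_singleton_self y) (w k - y)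
    rw [add_sub_cancel, hw1] at h1
    by_contra! h2
    nlinarith
  obtain ⟨k, hk, hk'⟩ := hnear.exists
  obtain ⟨l, ⟨hl, hl'⟩, hkl⟩ := (hnear.and (hU (eventually_gt_atTop k))).exists
  have h1 := (hσ' {k, l} fun i => if i = l then -1 else 1).1
  rw [Finset.sum_pair hkl.ne, Finset.sum_pair hkl.ne] at h1
  simp only [if_neg hkl.ne, if_true, norm_one, norm_neg, mul_one, one_smul, neg_smul] at h1
  have h2 : w k + -w l = (w k - y) - (w l - y) := by abel
  have h3 := norm_sub_le (w k - y) (w l - y)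
  rw [← h2] at h3
  simp only [hw] at h3 hk hl
  linarith

/-- Coordinatewise null sequences of unit vectors have subsequences spanning `ℓ¹`
asymptotically. -/
theorem exists_subseq_spansL1Asymp (hX : IsLEmbedded X) {u : ℕ → X} (hu0 : ∀ k, u k ≠ 0)
    (hu : ∀ n, Tendsto (fun k => b.unitCoord n (normalize' (u k))) atTop (𝓝 0)) :
    ∃ φ : ℕ → ℕ, StrictMono φ ∧ SpansL1Asymp fun n => u (φ n) := by
  set w : ℕ → X := fun k => normalize' (u k) with hw
  have hw1 : ∀ k, ‖w k‖ = 1 := fun k => norm_normalize' (hu0 k)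
  -- The ratios must be strictly below `1`, to leave room for an error at each step, although `c`
  -- tends to `1`.
  let c : ℕ → ℝ := fun n => 1 + 1 / ((n : ℝ) + 1)
  have hc1 : ∀ n, 1 ≤ c n := fun n => le_add_of_nonneg_right (by positivity)
  have hcn : ∀ n, c (n + 1) / c n < 1 := fun n => by
    rw [div_lt_one (zero_lt_one.trans_le (hc1 n))]
    simp only [c]
    gcongr
    simp
  have hcp : ∀ n, 0 < c (n + 1) / c n := fun n =>
    div_pos (zero_lt_one.trans_le (hc1 _)) (zero_lt_one.trans_le (hc1 _))
  have hf : ∀ j n : ℕ, ∃ K, ∀ k ≥ K, ∀ y ∈ Submodule.span ℂ (w '' Set.Iic j), ∀ a : ℂ,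
      c (n + 1) / c n * (‖y‖ + ‖a‖) ≤ ‖y + a • w k‖ := by
    intro j n
    have : FiniteDimensional ℂ (Submodule.span ℂ (w '' Set.Iic j)) :=
      FiniteDimensional.span_of_finite ℂ ((Set.finite_Iic j).image _)
    set ε := (1 - c (n + 1) / c n) / 2 with hε
    have hε0 : 0 < ε := by linarith [hcn n]
    obtain ⟨m, hm⟩ := h.exists_mul_le_add_proj hX (Submodule.span ℂ (w '' Set.Iic j)) hε0
      (by linarith [hcp n])
    obtain ⟨K, hK⟩ := eventually_atTop.1
      ((h.tendsto_proj_of_coord hu m).eventually_lt_const (half_pos hε0))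
    refine ⟨K, fun k hk y hy a => ?_⟩
    have h1 := hm y hy (a • w k)
    rw [map_smul, norm_smul, norm_smul, hw1, mul_one] at h1
    have h2 : ‖a‖ * ‖b.proj m (w k)‖ ≤ ‖a‖ * (ε / 2) :=
      mul_le_mul_of_nonneg_left (hK k hk).le (norm_nonneg a)
    have h3 : c (n + 1) / c n = 1 - 2 * ε := by rw [hε]; ring
    rw [h3]
    nlinarith [norm_nonneg y]
  choose f hf using hf
  let φ : ℕ → ℕ := fun n => Nat.rec 0 (fun n p => max (f p (n + 1)) (p + 1)) n
  have hφs : ∀ n, φ (n + 1) = max (f (φ n) (n + 1)) (φ n + 1) := fun n => rfl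
  have hφ : StrictMono φ := strictMono_nat_of_lt_succ fun n => by
    rw [hφs]
    exact lt_max_of_lt_right (Nat.lt_succ_self _)
  refine ⟨φ, hφ, spansL1Asymp_of_step (c := c) (fun n => hu0 _) hc1 ?_ ?_⟩
  · have h1 := (tendsto_one_div_add_atTop_nhds_zero_nat (𝕜 := ℝ)).const_add 1
    rwa [add_zero] at h1
  · intro n y hy a
    rcases n with - | n
    · have hy0 : y = 0 := by simpa using hy
      rw [hy0, norm_zero, zero_add (a • _), norm_smul, norm_normalize' (hu0 _), mul_one,
        zero_add ‖a‖]
      exact mul_le_of_le_one_left (norm_nonneg a) (hcn 0).le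
    · refine hf (φ n) (n + 1) (φ (n + 1)) ?_ y (Submodule.span_mono ?_ hy) a
      · rw [hφs]
        exact le_max_left _ _
      · rintro _ ⟨i, hi, rfl⟩
        exact ⟨φ i, hφ.monotone (Nat.lt_succ_iff.1 hi), rfl⟩

/-- Unless the norms tend to `0`, a subsequence is bounded away from `0`, and normalizing it
preserves coordinatewise convergence to `0`. -/
theorem exists_subseq_of_tendsto_coord (hX : IsLEmbedded X) {u : ℕ → X}
    (hu : ∀ n, Tendsto (fun k => b.unitCoord n (u k)) atTop (𝓝 0)) :
    ∃ φ : ℕ → ℕ, StrictMono φ ∧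
      (SpansL1Asymp (fun n => u (φ n)) ∨ Tendsto (fun n => ‖u (φ n)‖) atTop (𝓝 0)) := by
  by_cases h0 : Tendsto (fun n => ‖u n‖) atTop (𝓝 0)
  · exact ⟨id, strictMono_id, Or.inr h0⟩
  have h1 : ∃ ε > 0, ∃ᶠ k in atTop, ε ≤ ‖u k‖ := by
    by_contra! H
    refine h0 (Metric.tendsto_atTop'.2 fun ε hε => ?_)
    have h2 := H ε hε
    obtain ⟨N, hN⟩ := eventually_atTop.1 h2
    exact ⟨N, fun n hn => by simpa using hN n hn.le⟩
  obtain ⟨ε, hε, hfr⟩ := h1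
  obtain ⟨φ, hφ, hφ'⟩ := extraction_of_frequently_atTop hfr
  obtain ⟨ψ, hψ, hψ'⟩ := h.exists_subseq_spansL1Asymp hX (u := fun k => u (φ k))
    (fun k => norm_pos_iff.1 (hε.trans_le (hφ' k))) fun n => by
      have h2 := ((hu n).comp hφ.tendsto_atTop).norm.mul_const ε⁻¹
      rw [norm_zero, zero_mul] at h2
      refine squeeze_zero_norm (fun k => ?_) h2
      rw [normalize', map_smul, norm_smul, Complex.norm_real, norm_inv, norm_norm, mul_comm]
      exact mul_le_mul_of_nonneg_left (inv_anti₀ hε (hφ' k)) (norm_nonneg _)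
  exact ⟨fun n => φ (ψ n), hφ.comp hψ, Or.inl hψ'⟩

end IsAlmostL1

end SchauderBasis

end Sequences

/-! ### The abstract measure topology and its uniqueness. -/

section Topology

variable {X : Type*} [NormedAddCommGroup X] [NormedSpace ℂ X]

/-- Sequential spaces with the same convergent sequences have the same topology. -/
theorem topologicalSpace_le_of_seq {Y : Type*} {τ σ : TopologicalSpace Y}
    (hτ : @SequentialSpace Y τ)
    (h : ∀ (u : ℕ → Y) (a : Y), Tendsto u atTop (@nhds Y τ a) → Tendsto u atTop (@nhds Y σ a)) :
    τ ≤ σ := by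
  rw [← continuous_id_iff_le]
  exact (@continuous_iff_seqContinuous Y Y τ σ hτ id).2 fun {u a} => h u a

namespace SchauderBasis

/-- The topology of coordinatewise convergence. -/
@[reducible] noncomputable def coordTopology (b : SchauderBasis ℂ X) : TopologicalSpace X :=
  TopologicalSpace.induced (fun x n => b.unitCoord n x) inferInstance

/-- The finest topology that agrees with coordinatewise convergence on bounded sets. -/
@[reducible] noncomputable def boundedCoordTopology (b : SchauderBasis ℂ X) : TopologicalSpace X :=
  ⨆ r : ℝ, TopologicalSpace.coinduced (Subtype.val : {x : X | ‖x‖ ≤ r} → X)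
    (TopologicalSpace.induced Subtype.val b.coordTopology)

variable {b : SchauderBasis ℂ X} {δ : ℕ → ℝ}

theorem tendsto_coordTopology {u : ℕ → X} {a : X} :
    Tendsto u atTop (@nhds X b.coordTopology a) ↔
      ∀ n, Tendsto (fun k => b.unitCoord n (u k)) atTop (𝓝 (b.unitCoord n a)) := by
  rw [coordTopology, nhds_induced, tendsto_comap_iff, tendsto_pi_nhds]
  rfl

theorem boundedCoordTopology_le : b.boundedCoordTopology ≤ b.coordTopology :=
  iSup_le fun _ => by
    rw [← continuous_iff_coinduced_le]
    exact continuous_induced_dom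

theorem continuous_unitCoord_boundedCoordTopology (n : ℕ) :
    @Continuous X ℂ b.boundedCoordTopology _ fun x => b.unitCoord n x := by
  refine continuous_le_dom boundedCoordTopology_le ?_
  let := b.coordTopology
  have h1 : Continuous fun (x : X) (k : ℕ) => b.unitCoord k x := continuous_induced_dom
  exact (continuous_pi_iff.1 h1) n

/-- Balls carry a topology induced from a countable product of copies of `ℂ`, hence are
Fréchet–Urysohn; coinduced topologies and suprema preserve sequentiality. -/
theorem sequentialSpace_boundedCoordTopology : @SequentialSpace X b.boundedCoordTopology := by
  refine SequentialSpace.iSup fun r => ?_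
  let : TopologicalSpace {x : X | ‖x‖ ≤ r} := TopologicalSpace.induced Subtype.val b.coordTopology
  have hi : IsInducing fun (x : {x : X | ‖x‖ ≤ r}) (n : ℕ) => b.unitCoord n (x : X) :=
    ⟨induced_compose⟩
  have : FrechetUrysohnSpace {x : X | ‖x‖ ≤ r} := hi.frechetUrysohnSpace
  exact SequentialSpace.coinduced _

theorem tendsto_boundedCoordTopology_of_bounded {u : ℕ → X} {a : X} {C : ℝ}
    (hC : ∀ n, ‖u n‖ ≤ C)
    (hu : ∀ n, Tendsto (fun k => b.unitCoord n (u k)) atTop (𝓝 (b.unitCoord n a))) :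
    Tendsto u atTop (@nhds X b.boundedCoordTopology a) := by
  have h1 : b.boundedCoordTopology ≥ _ := le_iSup (fun r : ℝ =>
    TopologicalSpace.coinduced (Subtype.val : {x : X | ‖x‖ ≤ r} → X)
    (TopologicalSpace.induced Subtype.val b.coordTopology)) (max C ‖a‖)
  let : TopologicalSpace {x : X | ‖x‖ ≤ max C ‖a‖} :=
    TopologicalSpace.induced Subtype.val b.coordTopology
  let a' : {x : X | ‖x‖ ≤ max C ‖a‖} := ⟨a, le_max_right C ‖a‖⟩
  let u' : ℕ → {x : X | ‖x‖ ≤ max C ‖a‖} := fun n => ⟨u n, (hC n).trans (le_max_left _ _)⟩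
  have h3 : Tendsto u' atTop (𝓝 a') := by
    rw [@nhds_induced _ _ b.coordTopology, tendsto_comap_iff]
    exact tendsto_coordTopology.2 hu
  let := b.boundedCoordTopology
  have h2 : Continuous (Subtype.val : {x : X | ‖x‖ ≤ max C ‖a‖} → X) :=
    continuous_iff_coinduced_le.2 h1
  exact (h2.tendsto a').comp h3

theorem tendsto_coord_of_tendsto_norm {u : ℕ → X} (hu : Tendsto (fun k => ‖u k‖) atTop (𝓝 0))
    (n : ℕ) : Tendsto (fun k => b.unitCoord n (u k)) atTop (𝓝 0) := by
  simpa using! ((b.unitCoord n).continuous.tendsto 0).comp (tendsto_zero_iff_norm_tendsto_zero.2 hu)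

theorem tendsto_of_tendsto_norm {τ : TopologicalSpace X}
    (hτ : IsAbstractMeasureTopology τ) {u : ℕ → X} (hu : Tendsto (fun k => ‖u k‖) atTop (𝓝 0)) :
    Tendsto u atTop (@nhds X τ 0) := by
  refine Tendsto.mono_right ?_ (nhds_mono hτ.norm_le)
  rw [@tendsto_zero_iff_norm_tendsto_zero]
  exact hu

namespace IsAlmostL1

variable (h : b.IsAlmostL1 δ) [CompleteSpace X]
include h

theorem eq_of_unitCoord {x y : X} (hxy : ∀ n, b.unitCoord n x = b.unitCoord n y) : x = y := by
  refine (h.hasSum x).unique ?_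
  simp_rw [hxy]
  exact h.hasSum y

theorem t1Space_coordTopology : @T1Space X b.coordTopology := by
  let := b.coordTopology
  have hi : IsInducing fun (x : X) (n : ℕ) => b.unitCoord n x := ⟨rfl⟩
  have he : IsEmbedding fun (x : X) (n : ℕ) => b.unitCoord n x :=
    ⟨hi, fun x y hxy => h.eq_of_unitCoord fun n => congrFun hxy n⟩
  exact he.t1Space

/-- An unbounded sequence has a subsequence with norms tending to infinity and exceeding `‖a‖`. Its
range meets each ball in a finite set, so it is closed and misses `a`. -/
theorem bounded_of_tendsto_boundedCoordTopology {u : ℕ → X} {a : X}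
    (hu : Tendsto u atTop (@nhds X b.boundedCoordTopology a)) : ∃ C, ∀ n, ‖u n‖ ≤ C := by
  by_contra! H
  have hfr : ∀ k : ℕ, ∃ᶠ n in atTop, max (k : ℝ) ‖a‖ < ‖u n‖ := by
    intro k hk
    rw [eventually_atTop] at hk
    obtain ⟨N, hN⟩ := hk
    obtain ⟨n, hn⟩ := H (max (max (k : ℝ) ‖a‖) (∑ i ∈ Finset.range N, ‖u i‖))
    rcases lt_or_ge n N with hnN | hnN
    · have := Finset.single_le_sum (f := fun i => ‖u i‖) (fun _ _ => norm_nonneg _)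
        (Finset.mem_range.2 hnN)
      exact absurd (this.trans (le_max_right _ _)) (not_le.2 hn)
    · exact hN n hnN ((le_max_left _ _).trans_lt hn)
  obtain ⟨φ, hφ, hφ'⟩ := extraction_forall_of_frequently hfr
  have hclosed : @IsClosed X b.boundedCoordTopology (Set.range fun k => u (φ k)) := by
    rw [boundedCoordTopology, isClosed_iSup_iff]
    intro r
    rw [isClosed_coinduced]
    let : TopologicalSpace {x : X | ‖x‖ ≤ r} :=
      TopologicalSpace.induced Subtype.val b.coordTopology
    have : @T1Space X b.coordTopology := h.t1Space_coordTopology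
    have ht : T1Space {x : X | ‖x‖ ≤ r} := by
      let := b.coordTopology
      exact IsEmbedding.subtypeVal.t1Space
    refine Set.Finite.isClosed ?_
    refine Set.Finite.of_finite_image (f := Subtype.val) ?_ Subtype.val_injective.injOn
    obtain ⟨K, hK⟩ := exists_nat_gt r
    refine ((Set.finite_Iio K).image fun k => u (φ k)).subset ?_
    rintro _ ⟨⟨x, hx⟩, ⟨k, rfl⟩, rfl⟩
    refine ⟨k, Set.mem_Iio.2 (not_le.1 fun hk => ?_), rfl⟩
    have h1 : (K : ℝ) ≤ k := by exact_mod_cast hk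
    have h2 : ‖u (φ k)‖ ≤ r := hx
    linarith [hφ' k, le_max_left (k : ℝ) ‖a‖]
  have h1 := hu.comp hφ.tendsto_atTop
  have h2 : a ∈ Set.range fun k => u (φ k) :=
    @IsClosed.mem_of_tendsto X b.boundedCoordTopology _ _ _ _ _ _ hclosed h1 (Eventually.of_forall fun k => ⟨k, rfl⟩)
  obtain ⟨k, hk⟩ := h2
  have h3 := hφ' k
  simp only at hk
  rw [hk] at h3
  exact absurd (le_max_right (k : ℝ) ‖a‖) (not_le.2 h3)

theorem tendsto_boundedCoordTopology_iff {u : ℕ → X} {a : X} :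
    Tendsto u atTop (@nhds X b.boundedCoordTopology a) ↔ (∃ C, ∀ n, ‖u n‖ ≤ C) ∧
      ∀ n, Tendsto (fun k => b.unitCoord n (u k)) atTop (𝓝 (b.unitCoord n a)) :=
  ⟨fun hu => ⟨h.bounded_of_tendsto_boundedCoordTopology hu, tendsto_coordTopology.1
    (hu.mono_right (nhds_mono boundedCoordTopology_le))⟩,
    fun ⟨⟨_, hC⟩, hu⟩ => tendsto_boundedCoordTopology_of_bounded hC hu⟩

theorem tendsto_coord_of_bounded (hX : IsLEmbedded X) {u : ℕ → X} {C : ℝ} (hC : ∀ n, ‖u n‖ ≤ C)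
    (hu : SpansL1Asymp u) (n : ℕ) :
    Tendsto (fun k => b.unitCoord n (u k)) atTop (𝓝 0) := by
  have h2 := (h.tendsto_coord_of_spansL1Asymp hX hu n).norm.const_mul C
  rw [norm_zero, mul_zero] at h2
  refine squeeze_zero_norm (fun k => ?_) h2
  conv_lhs => rw [← norm_smul_normalize' (hu.1 k), map_smul, norm_smul, Complex.norm_real, norm_norm]
  exact mul_le_mul_of_nonneg_right (hC k) (norm_nonneg _)

/-- The null sequences of an abstract measure topology are the bounded coordinatewise null
sequences. -/
theorem tendsto_zero_iff_of_isAbstractMeasureTopology (hX : IsLEmbedded X)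
    {τ : TopologicalSpace X} (hτ : IsAbstractMeasureTopology τ) {u : ℕ → X} :
    Tendsto u atTop (@nhds X τ 0) ↔ (∃ C, ∀ n, ‖u n‖ ≤ C) ∧
      ∀ n, Tendsto (fun k => b.unitCoord n (u k)) atTop (𝓝 0) := by
  refine ⟨fun hu => ⟨(hτ.of_tendsto u hu).1, fun n => ?_⟩, fun ⟨⟨C, hC⟩, hu⟩ => ?_⟩
  · obtain ⟨C, hC⟩ := (hτ.of_tendsto u hu).1
    refine tendsto_of_subseq_tendsto fun ns hns => ?_
    obtain ⟨-, φ, -, hφ'⟩ := hτ.of_tendsto _ (hu.comp hns)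
    refine ⟨φ, ?_⟩
    rcases hφ' with h1 | h1
    · exact h.tendsto_coord_of_bounded hX (fun k => hC _) h1 n
    · exact tendsto_coord_of_tendsto_norm h1 n
  -- It suffices that every subsequence has a further `τ`-null subsequence, and both alternatives
  -- provided by the dichotomy are `τ`-null.
  · refine tendsto_of_subseq_tendsto fun ns hns => ?_
    obtain ⟨φ, -, hφ'⟩ := h.exists_subseq_of_tendsto_coord hX (u := fun k => u (ns k))
      fun n => (hu n).comp hns
    refine ⟨φ, ?_⟩
    rcases hφ' with h1 | h1
    · exact hτ.tendsto_of_spans _ ⟨C, fun k => hC _⟩ h1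
    · exact tendsto_of_tendsto_norm hτ h1

theorem isAbstractMeasureTopology (hX : IsLEmbedded X) :
    IsAbstractMeasureTopology b.boundedCoordTopology where
  sequential := sequentialSpace_boundedCoordTopology
  unique_limit u x y hx hy := h.eq_of_unitCoord fun n => tendsto_nhds_unique
    ((h.tendsto_boundedCoordTopology_iff.1 hx).2 n) ((h.tendsto_boundedCoordTopology_iff.1 hy).2 n)
  norm_le := topologicalSpace_le_of_seq inferInstance fun u a hu => by
    obtain ⟨C, hC⟩ := hu.norm.bddAbove_range
    exact tendsto_boundedCoordTopology_of_bounded (fun n => hC ⟨n, rfl⟩) fun n =>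
      ((b.unitCoord n).continuous.tendsto a).comp hu
  translation u a := by
    rw [h.tendsto_boundedCoordTopology_iff, h.tendsto_boundedCoordTopology_iff]
    refine and_congr ⟨fun ⟨C, hC⟩ => ⟨C + ‖a‖, fun n => (norm_sub_le _ _).trans ?_⟩,
      fun ⟨C, hC⟩ => ⟨C + ‖a‖, fun n => ?_⟩⟩ (forall_congr' fun n => ?_)
    · gcongr
      exact hC n
    · exact (norm_le_norm_sub_add (u n) a).trans (by gcongr; exact hC n)
    · simp_rw [map_sub, map_zero]
      exact tendsto_sub_nhds_zero_iff.symm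
  tendsto_of_spans u := fun ⟨C, hC⟩ hu => tendsto_boundedCoordTopology_of_bounded hC fun n => by
    simpa using h.tendsto_coord_of_bounded hX hC hu n
  of_tendsto u hu := by
    rw [h.tendsto_boundedCoordTopology_iff] at hu
    exact ⟨hu.1, h.exists_subseq_of_tendsto_coord hX fun n => by simpa using hu.2 n⟩

theorem eq_boundedCoordTopology (hX : IsLEmbedded X) {τ : TopologicalSpace X}
    (hτ : IsAbstractMeasureTopology τ) : τ = b.boundedCoordTopology := by
  have key : ∀ {σ τ : TopologicalSpace X}, IsAbstractMeasureTopology σ →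
      IsAbstractMeasureTopology τ → σ ≤ τ := fun {σ τ} hσ hτ =>
    topologicalSpace_le_of_seq hσ.sequential fun u a hu => by
      rw [hσ.translation, h.tendsto_zero_iff_of_isAbstractMeasureTopology hX hσ] at hu
      rwa [hτ.translation, h.tendsto_zero_iff_of_isAbstractMeasureTopology hX hτ]
  exact le_antisymm (key hτ (h.isAbstractMeasureTopology hX))
    (key (h.isAbstractMeasureTopology hX) hτ)

/-- The unit vectors are `τ`-null, so continuity on the ball forces `z (e_n) → 0`. Conversely such a
`z` is, uniformly on the ball, a limit of finite combinations of `τ`-continuous coordinates. -/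
theorem sharp_boundedCoordTopology : sharp b.boundedCoordTopology = b.coordSpan := by
  ext z
  rw [h.mem_coordSpan_iff]
  constructor
  · intro hz
    have h0 := hz 0 (by simp)
    have h1 : Tendsto b.unitVec atTop (@nhds X b.boundedCoordTopology 0) := by
      refine tendsto_boundedCoordTopology_of_bounded (fun n => (h.norm_unitVec n).le) fun n => ?_
      rw [map_zero]
      refine tendsto_const_nhds.congr' ?_
      filter_upwards [eventually_gt_atTop n] with k hk
      rw [unitCoord_unitVec h.ne_zero, if_neg hk.ne]
    have h2 := Tendsto.comp h0 (tendsto_inf.2 ⟨h1, tendsto_principal.2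
      (Eventually.of_forall fun n => (h.norm_unitVec n).le)⟩)
    simpa using! h2
  · intro hz
    have h1 := h.tendsto_sum_unitCoord hz
    have h2 : TendstoUniformlyOn (fun (n : ℕ) (x : X) =>
        (∑ i ∈ Finset.range n, z (b.unitVec i) • b.unitCoord i) x) (fun x => z x) atTop
        {x : X | ‖x‖ ≤ 1} := by
      rw [Metric.tendstoUniformlyOn_iff]
      intro ε hε
      filter_upwards [Metric.tendsto_nhds.1 h1 ε hε] with n hn x hx
      rw [dist_comm, dist_eq_norm, ← sub_apply]
      rw [dist_eq_norm] at hn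
      exact ((ContinuousLinearMap.le_opNorm _ x).trans
        (mul_le_of_le_one_right (norm_nonneg _) hx)).trans_lt hn
    let := b.boundedCoordTopology
    refine h2.continuousOn (Frequently.of_forall fun n => ?_)
    simp only [_root_.sum_apply, smul_apply]
    have h3 : ∀ i ∈ Finset.range n, Continuous fun x => z (b.unitVec i) • b.unitCoord i x :=
      fun i _ => (continuous_unitCoord_boundedCoordTopology i).const_smul (z (b.unitVec i))
    exact (continuous_finsetSum _ h3).continuousOn

end IsAlmostL1

end SchauderBasis

end Topology

/-! ### The predual: duality, M-embeddedness and `c₀`-estimates. -/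

section Predual

variable {X : Type*} [NormedAddCommGroup X] [NormedSpace ℂ X]

local notation "ι" => NormedSpace.inclusionInDoubleDual ℂ

theorem normalize'_smul {r : ℝ} (hr : 0 < r) (x : X) : normalize' ((r : ℂ) • x) = normalize' x := by
  have : (r : ℂ) ≠ 0 := by exact_mod_cast hr.ne'
  rw [normalize', normalize', norm_smul, Complex.norm_real, Real.norm_of_nonneg hr.le, smul_smul,
    mul_inv, mul_comm r⁻¹, Complex.ofReal_mul, mul_assoc, Complex.ofReal_inv r,
    inv_mul_cancel₀ this, mul_one]

theorem isClosed_canonicalCopy [CompleteSpace X] : IsClosed (canonicalCopy X : Set (NDual (NDual X))) :=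
  (NormedSpace.inclusionInDoubleDualLi ℂ (E := X)).isometry.isClosedEmbedding.isClosed_range

/-- A Banach space is M-embedded if the canonical projection on its third dual is an
L-projection. -/
theorem isMEmbedded_of_norm_eq [CompleteSpace X]
    (hX : ∀ Φ : NDual (NDual (NDual X)),
      ‖Φ‖ = ‖Φ.comp (ι X)‖ + ‖Φ - ι (NDual X) (Φ.comp (ι X))‖) : IsMEmbedded X := by
  refine ⟨isClosed_canonicalCopy, ?_⟩
  let R : NDual (NDual (NDual X)) →L[ℂ] NDual X := ContinuousLinearMap.precomp ℂ (ι X)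
  let E : NDual (NDual (NDual X)) →L[ℂ] NDual (NDual (NDual X)) := (ι (NDual X)).comp R
  have hE : IsLprojection (NDual (NDual (NDual X))) E := by
    refine ⟨ContinuousLinearMap.ext fun Φ => rfl, fun Φ => ?_⟩
    rw [hX Φ, ← norm_inclusionInDoubleDual (Φ.comp (ι X))]
    rfl
  -- The kernel of `E` is the annihilator of the canonical copy, so the complementary L-projection
  -- has it as range.
  refine ⟨1 - E, hE.Lcomplement, ?_⟩
  ext Φ
  rw [StrongDual.mem_polarSubmodule]
  constructor
  · rintro ⟨Ψ, rfl⟩ _ ⟨z, rfl⟩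
    exact sub_self (Ψ (ι X z))
  · intro hΦ
    have h1 : R Φ = 0 := ContinuousLinearMap.ext fun z => hΦ _ ⟨z, rfl⟩
    refine ⟨Φ, ?_⟩
    change Φ - ι (NDual X) (R Φ) = Φ
    rw [h1, map_zero, sub_zero]

/-- The adjoint of the inverse of an isometric isomorphism. -/
noncomputable def dualIsometryEquiv {Y : Type*} [NormedAddCommGroup Y] [NormedSpace ℂ Y]
    (J : X ≃ₗᵢ[ℂ] Y) : NDual X →L[ℂ] NDual Y :=
  ContinuousLinearMap.precomp ℂ (J.symm.toContinuousLinearEquiv : Y →L[ℂ] X)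

theorem dualIsometryEquiv_apply {Y : Type*} [NormedAddCommGroup Y] [NormedSpace ℂ Y]
    (J : X ≃ₗᵢ[ℂ] Y) (f : NDual X) (y : Y) : dualIsometryEquiv J f y = f (J.symm y) := rfl

theorem norm_comp_dualIsometryEquiv {Y : Type*} [NormedAddCommGroup Y] [NormedSpace ℂ Y]
    (J : X ≃ₗᵢ[ℂ] Y) (Φ : NDual (NDual Y)) : ‖Φ.comp (dualIsometryEquiv J)‖ = ‖Φ‖ := by
  have h1 : ∀ f, ‖dualIsometryEquiv J f‖ = ‖f‖ := fun f =>
    ContinuousLinearMap.opNorm_comp_linearIsometryEquiv f J.symm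
  refine le_antisymm (ContinuousLinearMap.opNorm_le_bound _ (norm_nonneg Φ) fun f => ?_)
    (ContinuousLinearMap.opNorm_le_bound _ (norm_nonneg (Φ.comp (dualIsometryEquiv J))) fun ψ => ?_)
  · rw [← h1 f]
    exact Φ.le_opNorm _
  · obtain ⟨f, rfl⟩ : ∃ f, dualIsometryEquiv J f = ψ :=
      ⟨ψ.comp (J.toContinuousLinearEquiv : X →L[ℂ] Y), by
        ext y
        simp [dualIsometryEquiv_apply]⟩
    rw [h1]
    exact (Φ.comp (dualIsometryEquiv J)).le_opNorm f

namespace SchauderBasis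

variable {b : SchauderBasis ℂ X} {δ : ℕ → ℝ}

/-- Evaluation of the functionals in the closed span of the coordinates. -/
noncomputable def evalCoordSpan (b : SchauderBasis ℂ X) : X →ₗ[ℂ] NDual b.coordSpan where
  toFun x := (ι X x).comp b.coordSpan.subtypeL
  map_add' x y := by ext; simp
  map_smul' c x := by ext; simp

theorem evalCoordSpan_apply (x : X) (z : b.coordSpan) : b.evalCoordSpan x z = (z : NDual X) x := rfl

namespace IsAlmostL1

variable (h : b.IsAlmostL1 δ)
include h

/-- Two-sided estimates for combinations of the normalized coordinate functionals. -/
theorem norm_sum_smul_normalize'_unitCoord [CompleteSpace X] {s : Finset ℕ} {w : ℕ → ℝ}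
    (hw0 : ∀ n, 0 < w n) (hw : ∀ x, ∑ n ∈ s, w n * ‖b.unitCoord n x‖ ≤ ‖x‖) (α : ℕ → ℂ) :
    (∀ k ∈ s, w k * ‖α k‖ ≤ ‖∑ n ∈ s, α n • normalize' (b.coord n)‖) ∧
      ∀ c, 0 ≤ c → (∀ n ∈ s, (w n)⁻¹ * ‖α n‖ ≤ c) →
        ‖∑ n ∈ s, α n • normalize' (b.coord n)‖ ≤ c := by
  have h1 : ∀ n, 1 ≤ ‖b.unitCoord n‖ := fun n => by
    have h2 := (b.unitCoord n).le_opNorm (b.unitVec n)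
    rwa [unitCoord_unitVec h.ne_zero, if_pos rfl, norm_one, h.norm_unitVec, mul_one] at h2
  have h2 : ∀ n x, normalize' (b.coord n) x = (‖b.unitCoord n‖⁻¹ : ℝ) * b.unitCoord n x := by
    intro n x
    rw [← normalize'_smul (norm_pos_iff.2 (h.ne_zero n)) (b.coord n)]
    rfl
  constructor
  · intro k hk
    have h3 : (∑ n ∈ s, α n • normalize' (b.coord n)) (b.unitVec k) =
        α k * (‖b.unitCoord k‖⁻¹ : ℝ) := by
      simp only [_root_.sum_apply, smul_apply, h2, unitCoord_unitVec h.ne_zero]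
      simp [hk]
    have h4 := (∑ n ∈ s, α n • normalize' (b.coord n)).le_opNorm (b.unitVec k)
    rw [h3, h.norm_unitVec, mul_one, norm_mul, Complex.norm_real,
      Real.norm_of_nonneg (by positivity), mul_comm] at h4
    refine le_trans (mul_le_mul_of_nonneg_right ?_ (norm_nonneg _)) h4
    rw [le_inv_comm₀ (hw0 k) (zero_lt_one.trans_le (h1 k))]
    refine ContinuousLinearMap.opNorm_le_bound _ (inv_nonneg.2 (hw0 k).le) fun x => ?_
    rw [inv_mul_eq_div, le_div_iff₀' (hw0 k)]
    exact (Finset.single_le_sum (f := fun n => w n * ‖b.unitCoord n x‖)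
      (fun n _ => mul_nonneg (hw0 n).le (norm_nonneg _)) hk).trans (hw x)
  · intro c hc hα
    refine ContinuousLinearMap.opNorm_le_bound _ hc fun x => ?_
    simp only [_root_.sum_apply, smul_apply, h2]
    have h5 : ∀ n ∈ s, ‖α n • (((‖b.unitCoord n‖⁻¹ : ℝ) : ℂ) * b.unitCoord n x)‖ ≤
        c * (w n * ‖b.unitCoord n x‖) := by
      intro n hn
      have h3 := hα n hn
      rw [inv_mul_eq_div, div_le_iff₀ (hw0 n)] at h3
      rw [norm_smul, norm_mul, Complex.norm_real, Real.norm_of_nonneg (by positivity)]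
      have h4 : ‖b.unitCoord n‖⁻¹ * ‖b.unitCoord n x‖ ≤ ‖b.unitCoord n x‖ :=
        mul_le_of_le_one_left (norm_nonneg _) (inv_le_one_of_one_le₀ (h1 n))
      rw [← mul_assoc c]
      exact mul_le_mul h3 h4 (by positivity) (mul_nonneg hc (hw0 n).le)
    refine (norm_sum_le_of_le s h5).trans ?_
    rw [← Finset.mul_sum]
    exact mul_le_mul_of_nonneg_left (hw x) hc

variable [CompleteSpace X]

/-- A norm-preserving extension of the evaluation at `x` differs from `x` by an annihilating
functional, and adding such a functional cannot lower the norm below `‖x‖`. -/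
theorem norm_evalCoordSpan (hX : IsLEmbedded X) (x : X) : ‖b.evalCoordSpan x‖ = ‖x‖ := by
  refine le_antisymm (ContinuousLinearMap.opNorm_le_bound _ (norm_nonneg _) fun z => ?_) ?_
  · rw [evalCoordSpan_apply, mul_comm]
    exact (z : NDual X).le_opNorm x
  · obtain ⟨φ, hφ, hφ'⟩ := exists_extension_norm_eq b.coordSpan (b.evalCoordSpan x)
    have h1 : b.Annihilates (φ - ι X x) := h.annihilates_iff.2 fun z hz => by
      rw [sub_apply, hφ ⟨z, hz⟩, NormedSpace.dual_def, evalCoordSpan_apply, sub_self]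
    have h2 := h.norm_add_of_annihilates hX h1 x
    rw [sub_add_cancel, hφ'] at h2
    linarith [norm_nonneg (φ - ι X x)]

theorem surjective_evalCoordSpan : Function.Surjective b.evalCoordSpan := by
  intro f
  obtain ⟨φ, hφ, -⟩ := exists_extension_norm_eq b.coordSpan f
  obtain ⟨x, hx⟩ := h.exists_annihilates_sub φ
  refine ⟨x, ContinuousLinearMap.ext fun z => ?_⟩
  have h1 := h.annihilates_iff.1 hx z z.2
  rw [sub_apply, NormedSpace.dual_def, sub_eq_zero, hφ z] at h1
  exact h1.symm

theorem exists_isometryEquiv (hX : IsLEmbedded X) :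
    ∃ J : X ≃ₗᵢ[ℂ] NDual b.coordSpan, ∀ (x : X) (z : b.coordSpan), J x z = (z : NDual X) x :=
  ⟨LinearIsometryEquiv.ofSurjective ⟨b.evalCoordSpan, h.norm_evalCoordSpan hX⟩
    h.surjective_evalCoordSpan, fun _ _ => rfl⟩

/-- Through `J` the third dual of the span is `X''`, and restriction to the span followed by the
canonical embedding becomes the projection onto `X` along the annihilating functionals. -/
theorem isMEmbedded_coordSpan (hX : IsLEmbedded X) : IsMEmbedded b.coordSpan := by
  have : CompleteSpace b.coordSpan := (Submodule.isClosed_topologicalClosure _).completeSpace_coe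
  obtain ⟨J, hJ⟩ := h.exists_isometryEquiv hX
  refine isMEmbedded_of_norm_eq fun Φ => ?_
  have h1 : b.Annihilates (Φ.comp (dualIsometryEquiv J) - ι X (J.symm (Φ.comp (ι b.coordSpan)))) :=
    h.annihilates_iff.2 fun z hz => by
      have h2 : dualIsometryEquiv J z = ι b.coordSpan ⟨z, hz⟩ := by
        ext φ
        rw [dualIsometryEquiv_apply, NormedSpace.dual_def]
        exact (hJ (J.symm φ) ⟨z, hz⟩).symm.trans (by rw [J.apply_symm_apply])
      have h3 : z (J.symm (Φ.comp (ι b.coordSpan))) = Φ (ι b.coordSpan ⟨z, hz⟩) :=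
        (hJ (J.symm _) ⟨z, hz⟩).symm.trans (by rw [J.apply_symm_apply]; rfl)
      rw [sub_apply, NormedSpace.dual_def, h3, sub_eq_zero, ← h2]
      rfl
  have h2 := h.norm_add_of_annihilates hX h1 (J.symm (Φ.comp (ι b.coordSpan)))
  have h3 : ι X (J.symm (Φ.comp (ι b.coordSpan))) =
      (ι (NDual b.coordSpan) (Φ.comp (ι b.coordSpan))).comp (dualIsometryEquiv J) := rfl
  rw [sub_add_cancel, h3, ← ContinuousLinearMap.sub_comp, norm_comp_dualIsometryEquiv,
    norm_comp_dualIsometryEquiv, J.symm.norm_map] at h2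
  rw [h2, add_comm]

theorem exists_schauderBasis_coordSpan :
    ∃ c : SchauderBasis ℂ b.coordSpan, ∀ n, (c n : NDual X) = b.coord n := by
  have hmem : ∀ n, b.coord n ∈ b.coordSpan := fun n =>
    subset_closure (Submodule.subset_span ⟨n, rfl⟩)
  refine ⟨{ basis := fun n => ⟨b.coord n, hmem n⟩
            coord := fun n => b.evalCoordSpan (b n)
            ortho := fun i j => ?_
            expansion := fun z => ?_ }, fun n => rfl⟩
  · rw [evalCoordSpan_apply, b.ortho]
    simp [Pi.single_apply, eq_comm]
  · rw [HasSum, SummationFilter.conditional_filter_eq_map_range, tendsto_map'_iff,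
      tendsto_subtype_rng]
    refine (h.tendsto_sum_unitCoord (h.mem_coordSpan_iff.1 z.2)).congr fun n => ?_
    rw [Function.comp_apply, AddSubmonoidClass.coe_finsetSum]
    refine Finset.sum_congr rfl fun i _ => ?_
    change _ = (z : NDual X) (b i) • b.coord i
    conv_rhs => rw [← norm_smul_normalize' (h.ne_zero i)]
    rw [map_smul, smul_eq_mul, mul_comm, mul_smul]
    rfl

omit h [CompleteSpace X] in
theorem norm_sum_smul_normalize'_coe {c : ℕ → b.coordSpan}
    (hc : ∀ n, (c n : NDual X) = b.coord n) (s : Finset ℕ) (α : ℕ → ℂ) :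
    ‖∑ n ∈ s, α n • normalize' (c n)‖ = ‖∑ n ∈ s, α n • normalize' (b.coord n)‖ := by
  rw [Submodule.coe_norm, AddSubmonoidClass.coe_finsetSum]
  refine congrArg _ (Finset.sum_congr rfl fun n _ => ?_)
  rw [← hc]
  rfl

omit h [CompleteSpace X] in
theorem ne_zero_of_coe_eq_coord {c : ℕ → b.coordSpan}
    (hc : ∀ n, (c n : NDual X) = b.coord n) (n : ℕ) : c n ≠ 0 := by
  intro h0
  have h1 := b.ortho n n
  rw [← hc, h0] at h1
  simp at h1

/-- The `c₀`-bounds dualize an estimate valid for all `x`, not only for `x` in the tail; hence `γ`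
from `exists_isNullSeq_l1Norm` replaces the given `δ`. -/
theorem spansC0Almost (hX : IsLEmbedded X) {c : ℕ → b.coordSpan}
    (hc : ∀ n, (c n : NDual X) = b.coord n) : SpansC0Almost c := by
  obtain ⟨γ, hγ, hγ'⟩ := h.exists_isNullSeq_l1Norm hX
  refine ⟨ne_zero_of_coe_eq_coord hc, γ, hγ, fun m m' hm α => ?_⟩
  have hpos : 0 < 1 - γ m := by linarith [(hγ.1 m).2]
  have hw : ∀ x, ∑ n ∈ Finset.Icc m m', (1 - γ m) * ‖b.unitCoord n x‖ ≤ ‖x‖ := fun x => by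
    rw [← Finset.mul_sum]
    refine le_trans (mul_le_mul_of_nonneg_left ?_ hpos.le) (hγ' m x)
    refine le_trans (Finset.sum_le_sum fun n hn => ?_)
      ((h.summable (x - b.proj m x)).sum_le_tsum (Finset.Icc m m') fun _ _ => norm_nonneg _)
    rw [map_sub, unitCoord_proj h.ne_zero, if_neg (not_lt.2 (Finset.mem_Icc.1 hn).1), sub_zero]
  have key := h.norm_sum_smul_normalize'_unitCoord (w := fun _ => 1 - γ m) (fun _ => hpos) hw α
  rw [norm_sum_smul_normalize'_coe hc]
  have hsup : ∀ n ∈ Finset.Icc m m', ‖α n‖ ≤ (Finset.Icc m m').sup' (Finset.nonempty_Icc.2 hm)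
      (fun n => ‖α n‖) := fun n hn => Finset.le_sup' (fun n => ‖α n‖) hn
  constructor
  · obtain ⟨k, hk, hk'⟩ := Finset.exists_mem_eq_sup' (Finset.nonempty_Icc.2 hm) fun n => ‖α n‖
    rw [hk']
    exact key.1 k hk
  · refine key.2 _ (mul_nonneg (inv_nonneg.2 hpos.le) ?_) fun n hn =>
      mul_le_mul_of_nonneg_left (hsup n hn) (inv_nonneg.2 hpos.le)
    exact (norm_nonneg _).trans (hsup m (Finset.mem_Icc.2 ⟨le_rfl, hm⟩))

/-- Here the weighted lower estimate of the basis already holds for all `x`, so it dualizes directly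
with the same null sequence. -/
theorem spansC0Asymp (hb : SpansL1Asymp b) {c : ℕ → b.coordSpan}
    (hc : ∀ n, (c n : NDual X) = b.coord n) : SpansC0Asymp c := by
  obtain ⟨-, σ, hσ, hσ'⟩ := hb
  refine ⟨ne_zero_of_coe_eq_coord hc, σ, hσ, fun m α => ?_⟩
  have hpos : ∀ n, 0 < 1 - σ n := fun n => by linarith [(hσ.1 n).2]
  have hw : ∀ x, ∑ n ∈ Finset.range (m + 1), (1 - σ n) * ‖b.unitCoord n x‖ ≤ ‖x‖ := fun x => by
    refine ge_of_tendsto (b.tendsto_proj x).norm ?_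
    filter_upwards [eventually_ge_atTop (m + 1)] with N hN
    rw [proj_eq_sum h.ne_zero]
    exact (Finset.sum_le_sum_of_subset_of_nonneg (Finset.range_subset_range.2 hN) fun n _ _ =>
      mul_nonneg (hpos n).le (norm_nonneg _)).trans (hσ' _ _).1
  have key := h.norm_sum_smul_normalize'_unitCoord hpos hw α
  rw [norm_sum_smul_normalize'_coe hc]
  refine ⟨Finset.sup'_le _ _ key.1, key.2 _ ?_ fun n hn =>
    Finset.le_sup' (fun n => (1 - σ n)⁻¹ * ‖α n‖) hn⟩
  exact (mul_nonneg (inv_nonneg.2 (hpos 0).le) (norm_nonneg _)).trans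
    (Finset.le_sup' (fun n => (1 - σ n)⁻¹ * ‖α n‖) (Finset.mem_range.2 (Nat.succ_pos m)))

end IsAlmostL1

end SchauderBasis

end Predual

/-! ### Reduction of both hypotheses to `IsAlmostL1`, and assembly. -/

section Main

variable {X : Type*} [NormedAddCommGroup X] [NormedSpace ℂ X]

namespace SchauderBasis

variable {b : SchauderBasis ℂ X}

theorem exists_isAlmostL1_of_spansL1Almost (hb : SpansL1Almost b) : ∃ δ, b.IsAlmostL1 δ := by
  obtain ⟨δ, hδ, hδ'⟩ := hb
  refine ⟨δ, hδ, fun n => by simpa using (hδ' 0).2.1 n, fun m s hs α => ?_⟩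
  have h1 : s = (s.image fun n => n - m).map (addLeftEmbedding m) := by
    ext n
    simp only [Finset.mem_map, Finset.mem_image, addLeftEmbedding_apply]
    constructor
    · intro hn
      exact ⟨n - m, ⟨n, hn, rfl⟩, Nat.add_sub_cancel' (hs n hn)⟩
    · rintro ⟨_, ⟨k, hk, rfl⟩, rfl⟩
      rwa [Nat.add_sub_cancel' (hs k hk)]
  rw [h1, Finset.sum_map, Finset.sum_map]
  exact ((hδ' m).2.2 _ fun n => α (m + n)).1

theorem exists_isAlmostL1_of_spansL1Asymp (hb : SpansL1Asymp b) : ∃ δ, b.IsAlmostL1 δ := by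
  obtain ⟨hb0, σ, hσ, hσ'⟩ := hb
  obtain ⟨δ, hδ, hδ'⟩ := exists_isNullSeq (p := fun m ε => ∀ n ≥ m, σ n ≤ ε) (fun m => by
    -- A common bound below `1` for all `σ n`: all but finitely many are at most `1 / 2`, and the
    -- rest have a maximum below `1`.
    obtain ⟨N, hN⟩ := eventually_atTop.1 (hσ.2.eventually_le_const one_half_pos)
    obtain ⟨k, -, hk⟩ := (Finset.range (N + 1)).exists_max_image σ Finset.nonempty_range_add_one
    refine ⟨max (1 / 2) (σ k), le_max_of_le_right (hσ.1 k).1,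
      max_lt (by norm_num) (hσ.1 k).2, fun n _ => ?_⟩
    rcases le_or_gt N n with hn | hn
    · exact le_max_of_le_left (hN n hn)
    · exact le_max_of_le_right (hk n (Finset.mem_range.2 (by omega)))) fun ε hε _ => by
    obtain ⟨N, hN⟩ := eventually_atTop.1 (hσ.2.eventually_le_const hε)
    filter_upwards [eventually_ge_atTop N] with m hm n hn
    exact hN n (hm.trans hn)
  refine ⟨δ, hδ, hb0, fun m s hs α => le_trans ?_ (hσ' s α).1⟩
  rw [Finset.mul_sum]
  exact Finset.sum_le_sum fun n hn => mul_le_mul_of_nonneg_right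
    (by linarith [hδ' m n (hs n hn)]) (norm_nonneg _)

/-- The properties of `X^#` common to the almost isometric and the asymptotic case. -/
theorem IsAlmostL1.main [CompleteSpace X] {δ : ℕ → ℝ} (h : b.IsAlmostL1 δ) (hX : IsLEmbedded X)
    {Q : (Z : Submodule ℂ (NDual X)) → (ℕ → Z) → Prop}
    (hQ : ∀ c : ℕ → b.coordSpan, (∀ n, (c n : NDual X) = b.coord n) → Q b.coordSpan c) :
    (∃! τ : TopologicalSpace X, IsAbstractMeasureTopology τ) ∧
      ∀ τ : TopologicalSpace X, IsAbstractMeasureTopology τ →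
        sharp τ = (Submodule.span ℂ (Set.range b.coord)).topologicalClosure ∧
        IsMEmbedded (sharp τ) ∧
        (∃ J : X ≃ₗᵢ[ℂ] NDual (sharp τ), ∀ (x : X) (z : sharp τ), J x z = (z : NDual X) x) ∧
        (∃ c : SchauderBasis ℂ (sharp τ),
          (∀ n, (c n : NDual X) = b.coord n) ∧ Q (sharp τ) c) := by
  refine ⟨⟨_, h.isAbstractMeasureTopology hX, fun τ hτ => h.eq_boundedCoordTopology hX hτ⟩,
    fun τ hτ => ?_⟩
  have h1 : sharp τ = b.coordSpan := by
    rw [h.eq_boundedCoordTopology hX hτ]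
    exact h.sharp_boundedCoordTopology
  refine ⟨h1, ?_⟩
  rw [h1]
  obtain ⟨c, hc⟩ := h.exists_schauderBasis_coordSpan
  exact ⟨h.isMEmbedded_coordSpan hX, h.exists_isometryEquiv hX, c, hc, hQ c hc⟩

end SchauderBasis

end Main

theorem mainTheorem9 {X : Type*} [NormedAddCommGroup X] [NormedSpace ℂ X] [CompleteSpace X]
    (hX : IsLEmbedded X) (b : SchauderBasis ℂ X) :
    (SpansL1Almost b →
      (∃! τ : TopologicalSpace X, IsAbstractMeasureTopology τ) ∧
      ∀ τ : TopologicalSpace X, IsAbstractMeasureTopology τ →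
        sharp τ = (Submodule.span ℂ (Set.range b.coord)).topologicalClosure ∧
        IsMEmbedded (sharp τ) ∧
        (∃ J : X ≃ₗᵢ[ℂ] NDual (sharp τ), ∀ (x : X) (z : sharp τ), J x z = (z : NDual X) x) ∧
        (∃ c : SchauderBasis ℂ (sharp τ),
          (∀ n, (c n : NDual X) = b.coord n) ∧ SpansC0Almost c)) ∧
    (SpansL1Asymp b →
      (∃! τ : TopologicalSpace X, IsAbstractMeasureTopology τ) ∧
      ∀ τ : TopologicalSpace X, IsAbstractMeasureTopology τ →
        sharp τ = (Submodule.span ℂ (Set.range b.coord)).topologicalClosure ∧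
        IsMEmbedded (sharp τ) ∧
        (∃ J : X ≃ₗᵢ[ℂ] NDual (sharp τ), ∀ (x : X) (z : sharp τ), J x z = (z : NDual X) x) ∧
        (∃ c : SchauderBasis ℂ (sharp τ),
          (∀ n, (c n : NDual X) = b.coord n) ∧ SpansC0Asymp c)) := by

  constructor
  · intro hb
    obtain ⟨δ, h⟩ := b.exists_isAlmostL1_of_spansL1Almost hb
    exact h.main hX (Q := fun _ c => SpansC0Almost c) fun c hc => h.spansC0Almost hX hc
  · intro hb
    obtain ⟨δ, h⟩ := b.exists_isAlmostL1_of_spansL1Asymp hb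
    exact h.main hX (Q := fun _ c => SpansC0Asymp c) fun c hc => h.spansC0Asymp hb hc
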